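/- Let $K\ge 1$ and $[K]=\{1,\dots,K\}$, and let $\zeta=(\zeta^{(i)})_{i\in[K]}$ be a family of probability distributions on the set $\mathcal W_K=\bigsqcup_{n\ge 0}[K]^n$ of finite words in the types. Let $\mu^{(i)}$ be the push-forward of $\zeta^{(i)}$ under the map $\mathcal W_K\to\mathbb Z_+^K$ that counts the letters of each type in a word. Put $$m_{ij}=\sum_{\mathbf z\in\mathbb Z_+^K} z_j\,\mu^{(i)}(\{\mathbf z\}),\qquad M=(m_{ij})_{i,j\in[K]},\qquad \varphi^{(i)}(\mathbf s)=\sum_{\mathbf z\in\mathbb Z_+^K}\mu^{(i)}(\{\mathbf z\})\prod_{l\in[K]} s_l^{z_l},\qquad Q^{(i)}_{jk}=\frac{\partial^2\varphi^{(i)}}{\partial s_j\partial s_k}(\mathbf 1).$$ Assume (H): - (irreducibility) for all $i,j$ there is $n\ge 1$, possibly depending on $i,j$, with $(M^n)_{ij}>0$ (aperiodicity is not assumed); - (non-degeneracy) $\mu^{(i)}(\{\mathbf z:\sum_j z_j\ne 1\})>0$ for some $i$; - (criticality) all $m_{ij}$ are finite and the spectral radius of $M$ is $1$; - (finite variance)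 $Q^{(i)}_{jk}<\infty$ for all $i,j,k$. Let $\mathbf a,\mathbf b\in\mathbb R^K$ be the left and right eigenvectors of $M$ for the eigenvalue $1$, normalized by $\sum_j a_j=1$ and $\sum_j a_jb_j=1$. Let $\mathbf Q(\mathbf b)$ be the vector with entries $Q^{(i)}(\mathbf b)=\sum_{j,k}Q^{(i)}_{jk}b_jb_k$, $i\in[K]$. For $i\in[K]$ let $P^{(i)}$ be the law, on the set of finite $K$-type planar trees, of the Galton–Watson tree $T$ whose root has type $i$, in which different vertices have independent offspring and the children of a vertex of type $j$, read from left to right, have types given by a word with law $\zeta^{(j)}$. Let $\mathrm{ht}(T)$ be the maximal height (distance to the root) of a vertex of $T$. Then for every $i\in[K]$ $$n\,P^{(i)}(\mathrm{ht}(T)\ge n)\;\longrightarrow\;\frac{2\,b_i}{\mathbf a\cdot\mathbf Q(\mathbf b)}\qquad (n\to\infty).$$ -/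

import Mathlib

open MeasureTheory Filter Topology
open scoped ENNReal

namespace MultitypeGW

/-! ### Multitype offspring distributions

Types are the elements of `Fin K`.  An *ordered* offspring distribution is a family
`ζ : Fin K → PMF (List (Fin K))` of probability distributions on the finite words in the types; an
*unordered* one is a family `μ : Fin K → PMF (Fin K → ℕ)` of probability distributions on the
vectors of non-negative integers indexed by the types. -/

/-- The projection `p` from words to vectors: `typeCount w j` is the number of letters of the
word `w` that are equal to `j`. -/
def typeCount {K : ℕ} (w : List (Fin K)) : Fin K → ℕ := fun j => w.count j

/-- The unordered offspring distribution `μ = p_* ζ` of an ordered offspring distribution `ζ`. -/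
noncomputable def unordered {K : ℕ} (ζ : Fin K → PMF (List (Fin K))) :
    Fin K → PMF (Fin K → ℕ) :=
  fun i => (ζ i).map typeCount

/-- `μ` is non-degenerate: some type has, with positive probability, a total number of children
different from one. -/
def NonDegenerate {K : ℕ} (μ : Fin K → PMF (Fin K → ℕ)) : Prop :=
  ∃ i, 0 < (μ i).toMeasure {z : Fin K → ℕ | ∑ j, z j ≠ 1}

/-- The mean matrix, with entries in `[0, ∞]`: `m i j` is the mean number of children of type `j`
of an individual of type `i`. -/
noncomputable def meanMatrix {K : ℕ} (μ : Fin K → PMF (Fin K → ℕ)) :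
    Matrix (Fin K) (Fin K) ℝ≥0∞ :=
  fun i j => ∑' z : Fin K → ℕ, (z j : ℝ≥0∞) * μ i z

/-- The mean matrix with real entries (meaningful when all means are finite). -/
noncomputable def realMeanMatrix {K : ℕ} (μ : Fin K → PMF (Fin K → ℕ)) :
    Matrix (Fin K) (Fin K) ℝ :=
  fun i j => (meanMatrix μ i j).toReal

/-- Irreducibility: for all `i`, `j` there is `n ≥ 1`, which may depend on `i` and `j`, such that
the `(i, j)` entry of the `n`-th power of the mean matrix is positive. -/
def Irreducible {K : ℕ} (μ : Fin K → PMF (Fin K → ℕ)) : Prop :=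
  ∀ i j, ∃ n : ℕ, 1 ≤ n ∧ 0 < (meanMatrix μ ^ n) i j

/-- Criticality: all means are finite, and the maximal modulus of a (complex) eigenvalue of the
mean matrix is `1`. -/
def Critical {K : ℕ} (μ : Fin K → PMF (Fin K → ℕ)) : Prop :=
  (∀ i j, meanMatrix μ i j ≠ ∞) ∧
    spectralRadius ℂ ((realMeanMatrix μ).map (fun x : ℝ => (x : ℂ))) = 1

/-- `secondDeriv μ i j k` in `[0, ∞]` is the second partial derivative with respect to `s j` and
`s k`, at the vector with all entries `1`, of the generating function
`φ i s = ∑ z, μ i z * ∏ l, s l ^ z l`.  The derivative of the monomial `∏ l, s l ^ z l` at that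
point is `z j * z k` if `j ≠ k` and `z j * (z j - 1)` if `j = k`. -/
noncomputable def secondDeriv {K : ℕ} (μ : Fin K → PMF (Fin K → ℕ)) (i j k : Fin K) : ℝ≥0∞ :=
  ∑' z : Fin K → ℕ, ((if j = k then z j * (z j - 1) else z j * z k : ℕ) : ℝ≥0∞) * μ i z

/-- `μ` has finite variance. -/
def FiniteVariance {K : ℕ} (μ : Fin K → PMF (Fin K → ℕ)) : Prop :=
  ∀ i j k, secondDeriv μ i j k ≠ ∞

/-- The quadratic form `s ↦ ∑ j, ∑ k, Q i j k * s j * s k` on `ℝ^K` whose matrix is the Hessian at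
`(1, …, 1)` of the generating function of `μ i`. -/
noncomputable def quadForm {K : ℕ} (μ : Fin K → PMF (Fin K → ℕ)) (i : Fin K) (s : Fin K → ℝ) : ℝ :=
  ∑ j, ∑ k, (secondDeriv μ i j k).toReal * s j * s k

/-- The basic assumption (H). -/
structure BasicAssumption {K : ℕ} (μ : Fin K → PMF (Fin K → ℕ)) : Prop where
  irreducible : Irreducible μ
  nonDegenerate : NonDegenerate μ
  critical : Critical μ
  finiteVariance : FiniteVariance μ

/-! ### Multitype planar trees

Vertices are finite words on `ℕ`; the letters `0, 1, 2, …` number the children of a vertex from left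
to right (so the letter `l` stands for the `(l + 1)`-st child). -/

/-- A `K`-type planar tree: a finite set of words containing the empty word, closed under taking the
parent and the elder siblings, together with a type for each of its elements. -/
structure TypedTree (K : ℕ) where
  /-- the vertices -/
  verts : Finset (List ℕ)
  /-- the empty word is the root -/
  root_mem : [] ∈ verts
  /-- the parent of a vertex is a vertex -/
  parent_mem : ∀ (u : List ℕ) (l : ℕ), u ++ [l] ∈ verts → u ∈ verts
  /-- the elder siblings of a vertex are vertices -/
  sibling_mem : ∀ (u : List ℕ) (l l' : ℕ), u ++ [l] ∈ verts → l' ≤ l → u ++ [l'] ∈ verts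
  /-- the types of the vertices -/
  type : {u : List ℕ // u ∈ verts} → Fin K

/-- The maximal height (length) of a vertex. -/
def TypedTree.height {K : ℕ} (t : TypedTree K) : ℕ := t.verts.sup List.length

instance instMeasurableSpaceTypedTree (K : ℕ) : MeasurableSpace (TypedTree K) := ⊤

/-- Words in the types form a countable set, with the discrete σ-algebra. -/
instance instMeasurableSpaceWord (K : ℕ) : MeasurableSpace (List (Fin K)) := ⊤

/-! ### Galton-Watson trees

A point of the sample space is a family `W` of words in the types, `W (j, u)` being the word that
gives the types of the children of the vertex `u` if `u` is in the tree and has type `j`. -/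

/-- Starting from a vertex `u` of type `j`, follow the word `v`: the result is the type of the
descendant `u ++ v` of `u`, or `none` if `u ++ v` is not in the tree. -/
def follow {K : ℕ} (W : Fin K × List ℕ → List (Fin K)) :
    Fin K → List ℕ → List ℕ → Option (Fin K)
  | j, _, [] => some j
  | j, u, l :: v =>
    match (W (j, u))[l]? with
    | none => none
    | some k => follow W k (u ++ [l]) v

/-- `mark i W u` is the type of the vertex `u` of the random tree with root of type `i`, and `none`
if `u` is not in the tree. -/
def mark {K : ℕ} (i : Fin K) (W : Fin K × List ℕ → List (Fin K)) (u : List ℕ) : Option (Fin K) :=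
  follow W i [] u

/-- The (possibly infinite) vertex set of the random tree. -/
def vertexSet {K : ℕ} (i : Fin K) (W : Fin K × List ℕ → List (Fin K)) : Set (List ℕ) :=
  {u | (mark i W u).isSome}

theorem mark_nil {K : ℕ} (i : Fin K) (W : Fin K × List ℕ → List (Fin K)) :
    mark i W [] = some i := rfl

theorem follow_append {K : ℕ} (W : Fin K × List ℕ → List (Fin K)) (l : ℕ) (v : List ℕ) :
    ∀ (j : Fin K) (u : List ℕ), follow W j u (v ++ [l]) =
      (follow W j u v).bind (fun k => (W (k, u ++ v))[l]?) := by
  induction v with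
  | nil =>
    intro j u
    simp only [List.nil_append, follow, List.append_nil, Option.bind_some]
    cases (W (j, u))[l]? <;> rfl
  | cons a v ih =>
    intro j u
    simp only [List.cons_append, follow]
    cases h : (W (j, u))[a]? with
    | none => rfl
    | some k => simp only [ih, List.append_assoc, List.cons_append, List.nil_append]

/-- The recursive construction of the tree: if `u` is in the tree and has type `j`, then its
children are the words `u ++ [l]` with `l` smaller than the length of `W (j, u)`, and the type of
`u ++ [l]` is the corresponding letter of `W (j, u)`. -/
theorem mark_append {K : ℕ} (i : Fin K) (W : Fin K × List ℕ → List (Fin K)) (u : List ℕ) (l : ℕ) :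
    mark i W (u ++ [l]) = (mark i W u).bind (fun j => (W (j, u))[l]?) := by
  simp [mark, follow_append]

/-- The tree with one vertex, of type `i`. -/
def singleVertex {K : ℕ} (i : Fin K) : TypedTree K where
  verts := {[]}
  root_mem := by simp
  parent_mem := by simp
  sibling_mem := by simp
  type := fun _ => i

/-- The finite tree on the vertex set of the random tree, when this set is finite. -/
noncomputable def treeOfFinite {K : ℕ} (i : Fin K) (W : Fin K × List ℕ → List (Fin K))
    (h : (vertexSet i W).Finite) : TypedTree K where
  verts := h.toFinset
  root_mem := by simp [vertexSet, mark_nil]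
  parent_mem := by
    intro u l hu
    simp only [Set.Finite.mem_toFinset, vertexSet, Set.mem_ofPred_eq, mark_append] at hu ⊢
    cases hm : mark i W u <;> simp_all
  sibling_mem := by
    intro u l l' hu hl
    simp only [Set.Finite.mem_toFinset, vertexSet, Set.mem_ofPred_eq, mark_append] at hu ⊢
    cases hm : mark i W u with
    | none => simp_all
    | some j =>
      simp only [hm, Option.bind_some, isSome_getElem?] at hu ⊢
      exact lt_of_le_of_lt hl hu
  type := fun u => (mark i W u.1).get (by simpa [vertexSet] using u.2)

open Classical in
/-- The random tree with root of type `i`, as a (finite) planar tree.  The value on the event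
that the tree is infinite is immaterial, since for critical offspring distributions
this event has probability zero. -/
noncomputable def gwTree {K : ℕ} (i : Fin K) (W : Fin K × List ℕ → List (Fin K)) : TypedTree K :=
  if h : (vertexSet i W).Finite then treeOfFinite i W h else singleVertex i

/-- The law of the family `W` of words: they are independent, and `W (j, u)` has law `ζ j`. -/
noncomputable def wordLaw {K : ℕ} (ζ : Fin K → PMF (List (Fin K))) :
    Measure (Fin K × List ℕ → List (Fin K)) :=
  Measure.infinitePi (fun q : Fin K × List ℕ => (ζ q.1).toMeasure)

instance instIsProbabilityMeasureWordLaw {K : ℕ} (ζ : Fin K → PMF (List (Fin K))) :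
    IsProbabilityMeasure (wordLaw ζ) := by
  unfold wordLaw; infer_instance

/-- The law `P^(i)` of the Galton-Watson tree with ordered offspring distribution `ζ` and root of
type `i`, a measure on the set of `K`-type planar trees. -/
noncomputable def gwLaw {K : ℕ} (ζ : Fin K → PMF (List (Fin K))) (i : Fin K) :
    Measure (TypedTree K) :=
  (wordLaw ζ).map (gwTree i)

/-! The map `gwTree i` is measurable, so that `gwLaw ζ i` is a probability measure. -/

instance instCountableTypedTree (K : ℕ) : Countable (TypedTree K) := by
  let f : TypedTree K → (Σ s : Finset (List ℕ), ({u : List ℕ // u ∈ s} → Fin K)) :=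
    fun t => ⟨t.verts, t.type⟩
  refine Function.Injective.countable (f := f) ?_
  rintro ⟨s, h1, h2, h3, e⟩ ⟨s', h1', h2', h3', e'⟩ h
  simp only [f, Sigma.mk.injEq] at h
  obtain ⟨rfl, h⟩ := h
  simp only [heq_eq_eq] at h
  subst h
  rfl

theorem measurableSet_mark {K : ℕ} (i : Fin K) (u : List ℕ) :
    ∀ o, MeasurableSet {W : Fin K × List ℕ → List (Fin K) | mark i W u = o} := by
  induction u using List.reverseRecOn with
  | nil => intro o; simp [mark_nil]
  | append_singleton u l ih =>
    intro o
    have : {W : Fin K × List ℕ → List (Fin K) | mark i W (u ++ [l]) = o} =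
        ({W | mark i W u = none} ∩ {_W | o = none}) ∪
        ⋃ j : Fin K, ({W | mark i W u = some j} ∩
          (fun W : Fin K × List ℕ → List (Fin K) => W (j, u)) ⁻¹' {w | w[l]? = o}) := by
      ext W
      simp only [mark_append, Set.mem_ofPred_eq, Set.mem_union, Set.mem_inter_iff, Set.mem_iUnion,
        Set.mem_preimage]
      cases mark i W u <;> simp [eq_comm]
    rw [this]
    refine ((ih none).inter (MeasurableSet.const _)).union (MeasurableSet.iUnion fun j => ?_)
    exact (ih (some j)).inter (measurable_pi_apply (j, u) trivial)

theorem measurable_gwTree {K : ℕ} (i : Fin K) : Measurable (gwTree (K := K) i) := by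
  classical
  have hS : ∀ s : Finset (List ℕ),
      MeasurableSet {W : Fin K × List ℕ → List (Fin K) | vertexSet i W = s} := by
    intro s
    have : {W : Fin K × List ℕ → List (Fin K) | vertexSet i W = s} =
        ⋂ u : List ℕ, {W | mark i W u = none ↔ u ∉ s} := by
      ext W
      simp only [Set.mem_ofPred_eq, Set.mem_iInter, Set.ext_iff, vertexSet, Finset.mem_coe]
      refine forall_congr' fun u => ?_
      cases mark i W u <;> simp
    rw [this]
    refine MeasurableSet.iInter fun u => ?_
    by_cases hu : u ∈ s
    · have h := (measurableSet_mark i u none).compl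
      convert h using 1
      ext W
      simp [hu]
    · have h := measurableSet_mark i u none
      convert h using 1
      ext W
      simp [hu]
  refine measurable_to_countable' fun t => ?_
  have : gwTree i ⁻¹' {t} =
      ({W | vertexSet i W = t.verts} ∩
        ⋂ u : {u : List ℕ // u ∈ t.verts}, {W | mark i W u.1 = some (t.type u)}) ∪
      ((⋂ s : Finset (List ℕ), {W | vertexSet i W = s}ᶜ) ∩ {_W | singleVertex i = t}) := by
    ext W
    simp only [Set.mem_preimage, Set.mem_singleton_iff, Set.mem_union, Set.mem_inter_iff,
      Set.mem_ofPred_eq, Set.mem_iInter, Set.mem_compl_iff]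
    by_cases h : (vertexSet i W).Finite
    · have h' : ¬ ∀ s : Finset (List ℕ), ¬ vertexSet i W = s :=
        fun hs => hs h.toFinset (by simp)
      simp only [h', false_and, or_false]
      rw [gwTree, dif_pos h]
      constructor
      · rintro rfl
        exact ⟨by simp [treeOfFinite], fun u => by simp [treeOfFinite]⟩
      · rintro ⟨h1, h2⟩
        obtain ⟨s, a1, a2, a3, e⟩ := t
        have hs : h.toFinset = s := by ext u; simp [h1]
        subst hs
        simp only [treeOfFinite]
        congr 1
        funext u
        exact Option.get_of_eq_some _ (h2 u)
    · have h1 : ∀ s : Finset (List ℕ), ¬ vertexSet i W = s :=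
        fun s hs => h (hs ▸ s.finite_toSet)
      rw [gwTree, dif_neg h]
      simp [h1]
  rw [this]
  refine ((hS _).inter (MeasurableSet.iInter fun u => measurableSet_mark i _ _)).union
    ((MeasurableSet.iInter fun s => (hS s).compl).inter (MeasurableSet.const _))

instance instIsProbabilityMeasureGwLaw {K : ℕ} (ζ : Fin K → PMF (List (Fin K))) (i : Fin K) :
    IsProbabilityMeasure (gwLaw ζ i) :=
  Measure.isProbabilityMeasure_map (measurable_gwTree i).aemeasurable

end MultitypeGW

/-!
The proof is Kolmogorov's analysis of the survival probabilities, adapted to several types and to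
periodic mean matrices.

Let `h n i` be the probability that the tree with root of type `i` reaches height `n`
(`survProb`). The subtrees of the children of the root are independent, so `h (n + 1)` is the image
of `h n` under the map `h ↦ 1 - φ (1 - h)` (`survStep`; `wordLaw_dies`, `gwLaw_le_height`), which
is `M h` minus a remainder lying between `0` and half the quadratic form `Q h`
(`survStep_eq`, `survRem_le`) and asymptotic to it along small multiples of a convergent sequence
of directions, by dominated convergence (`tendsto_survRem_div`).

Perron–Frobenius theory gives positivity of the eigenvectors `a` and `b` and shows that every real
fixed vector of `M` has constant sign (`eigenvectors_pos`). Gelfand's formula enters through the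
fact that a nonnegative `c ≤ M c` is a fixed vector when the spectral radius is one.

Nondegeneracy and criticality force some word of positive probability to have two letters
(`exists_two_le_length`), so that `a · Q b > 0` and `h n → 0` (`tendsto_survProb_zero`).
The direction of `h n` converges to `b` (`tendsto_direction`). Without aperiodicity the powers of
`M` need not converge; instead `h (n + 1) ≤ h n` gives `M h ≤ h + O(‖h‖ ^ 2)`, and since
`a · M h = a · h`, this one-sided bound controls `M h - h` from both sides. Every limit point of the
directions is then a fixed vector of `M` paired to one with `a`, that is, `b`.

Finally `s n = a · h n` satisfies `s n - s (n + 1) ~ (a · Q b / 2) * s n ^ 2`, whence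
`n * s n → 2 / (a · Q b)` by Cesàro averaging of the increments of `1 / s n`
(`tendsto_nat_mul_of_quadratic`).
-/

namespace MultitypeGW

/-! ### Perron–Frobenius theory at the eigenvalue one -/

section PerronFrobenius

variable {ι : Type*} [Fintype ι]

theorem mulVec_nonneg {M : Matrix ι ι ℝ} (hM : ∀ i j, 0 ≤ M i j) {v : ι → ℝ}
    (hv : ∀ i, 0 ≤ v i) (i : ι) : 0 ≤ M.mulVec v i :=
  Finset.sum_nonneg fun j _ => mul_nonneg (hM i j) (hv j)

theorem mulVec_mono {M : Matrix ι ι ℝ} (hM : ∀ i j, 0 ≤ M i j) {v w : ι → ℝ}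
    (hvw : ∀ i, v i ≤ w i) (i : ι) : M.mulVec v i ≤ M.mulVec w i :=
  Finset.sum_le_sum fun j _ => mul_le_mul_of_nonneg_left (hvw j) (hM i j)

theorem abs_le_mulVec_abs {M : Matrix ι ι ℝ} (hM : ∀ i j, 0 ≤ M i j) {v : ι → ℝ}
    (hv : M.mulVec v = v) (i : ι) : |v i| ≤ M.mulVec (fun j => |v j|) i := by
  conv_lhs => rw [← hv]
  refine (Finset.abs_sum_le_sum_abs _ _).trans (le_of_eq ?_)
  refine Finset.sum_congr rfl fun j _ => ?_
  rw [abs_mul, abs_of_nonneg (hM i j)]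

variable [DecidableEq ι]

theorem pow_nonneg_entries {M : Matrix ι ι ℝ} (hM : ∀ i j, 0 ≤ M i j) (n : ℕ) :
    ∀ i j, 0 ≤ (M ^ n) i j := by
  induction n with
  | zero => intro i j; rw [pow_zero, Matrix.one_apply]; split_ifs <;> norm_num
  | succ n ih =>
    intro i j
    rw [pow_succ, Matrix.mul_apply]
    exact Finset.sum_nonneg fun k _ => mul_nonneg (ih i k) (hM k j)

theorem pow_mulVec_eq_self {M : Matrix ι ι ℝ} {v : ι → ℝ} (hv : M.mulVec v = v) (n : ℕ) :
    (M ^ n).mulVec v = v := by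
  induction n with
  | zero => simp
  | succ n ih => rw [pow_succ, ← Matrix.mulVec_mulVec, hv, ih]

theorem eq_zero_or_pos_of_mulVec_eq_self {M : Matrix ι ι ℝ} (hM : ∀ i j, 0 ≤ M i j)
    (hirr : ∀ i j, ∃ n : ℕ, 0 < (M ^ n) i j) {v : ι → ℝ} (hv : M.mulVec v = v)
    (h0 : ∀ i, 0 ≤ v i) : v = 0 ∨ ∀ i, 0 < v i := by
  by_cases h : v = 0
  · exact Or.inl h
  refine Or.inr fun i => ?_
  obtain ⟨j, hj⟩ := Function.ne_iff.mp h
  obtain ⟨n, hn⟩ := hirr i j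
  rw [← pow_mulVec_eq_self hv n]
  exact Finset.sum_pos' (fun k _ => mul_nonneg (pow_nonneg_entries hM n i k) (h0 k))
    ⟨j, Finset.mem_univ j, mul_pos hn (lt_of_le_of_ne (h0 j) (Ne.symm hj))⟩

/-- A fixed vector whose entrywise absolute value is also fixed has constant sign: both `|v| - v`
and `|v| + v` are nonnegative fixed vectors, and one of them vanishes somewhere. -/
theorem sign_of_mulVec_eq_self {M : Matrix ι ι ℝ} (hM : ∀ i j, 0 ≤ M i j)
    (hirr : ∀ i j, ∃ n : ℕ, 0 < (M ^ n) i j) {v : ι → ℝ} (hv : M.mulVec v = v)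
    (habs : M.mulVec (fun j => |v j|) = fun j => |v j|) :
    v = 0 ∨ (∀ i, 0 < v i) ∨ ∀ i, v i < 0 := by
  by_cases h : v = 0
  · exact Or.inl h
  right
  have hpos : ∀ i, 0 < |v i| := by
    rcases eq_zero_or_pos_of_mulVec_eq_self hM hirr habs fun i => abs_nonneg _ with h' | h'
    · exact absurd (funext fun i => abs_eq_zero.mp (congrFun h' i)) h
    · exact h'
  have h1 := eq_zero_or_pos_of_mulVec_eq_self hM hirr (v := (fun j => |v j|) - v)
    (by rw [Matrix.mulVec_sub, hv, habs]) (fun i => sub_nonneg.mpr (le_abs_self _))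
  have h2 := eq_zero_or_pos_of_mulVec_eq_self hM hirr (v := (fun j => |v j|) + v)
    (by rw [Matrix.mulVec_add, hv, habs])
    (fun i => by have := neg_abs_le (v i); simp only [Pi.add_apply]; linarith)
  rcases h1 with h1 | h1
  · left
    intro i
    have := congrFun h1 i
    have := hpos i
    simp only [Pi.sub_apply, Pi.zero_apply] at *
    linarith
  · rcases h2 with h2 | h2
    · right
      intro i
      have := congrFun h2 i
      have := hpos i
      simp only [Pi.add_apply, Pi.zero_apply] at *
      linarith
    · exfalso
      obtain ⟨j, hj⟩ := Function.ne_iff.mp h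
      have e1 := h1 j
      have e2 := h2 j
      simp only [Pi.add_apply, Pi.sub_apply] at e1 e2
      rcases abs_cases (v j) with ⟨h, _⟩ | ⟨h, _⟩ <;> linarith

attribute [local instance] Matrix.linftyOpNormedRing Matrix.linftyOpNormedAlgebra in
/-- If `M d ≥ (1 + ε) d` for a vector `d` with a positive entry, the norms of the powers of `M` grow
at least like `(1 + ε) ^ n`, so that by Gelfand's formula the spectral radius exceeds one. -/
theorem one_lt_spectralRadius {M : Matrix ι ι ℝ} (hM : ∀ i j, 0 ≤ M i j) {d : ι → ℝ}
    {i₀ : ι} (hd : 0 < d i₀) {ε : ℝ} (hε : 0 < ε)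
    (h : ∀ i, (1 + ε) * d i ≤ M.mulVec d i) :
    1 < spectralRadius ℂ (M.map (fun x : ℝ => (x : ℂ))) := by
  by_contra! hle
  set A : Matrix ι ι ℂ := M.map (fun x : ℝ => (x : ℂ)) with hA
  have hgrow : ∀ n : ℕ, ∀ i, (1 + ε) ^ n * d i ≤ (M ^ n).mulVec d i := by
    intro n
    induction n with
    | zero => simp
    | succ n ih =>
      intro i
      rw [pow_succ' M, ← Matrix.mulVec_mulVec]
      calc (1 + ε) ^ (n + 1) * d i = (1 + ε) ^ n * ((1 + ε) * d i) := by ring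
        _ ≤ (1 + ε) ^ n * M.mulVec d i := by gcongr; exact h i
        _ = M.mulVec ((1 + ε) ^ n • d) i := by rw [Matrix.mulVec_smul]; rfl
        _ ≤ _ := mulVec_mono hM (by simpa using ih) i
  have hpow : ∀ n : ℕ, A ^ n = (M ^ n).map (fun x : ℝ => (x : ℂ)) := fun n =>
    (Matrix.map_pow M Complex.ofRealHom n).symm
  have hnorm : ∀ n : ℕ, (1 + ε) ^ n * d i₀ ≤ ‖A ^ n‖ * ‖fun i => (d i : ℂ)‖ := by
    intro n
    refine (hgrow n i₀).trans ?_
    refine le_trans ?_ (Matrix.linfty_opNorm_mulVec (A ^ n) (fun i => (d i : ℂ)))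
    refine le_trans ?_ (norm_le_pi_norm _ i₀)
    have : (A ^ n).mulVec (fun i => (d i : ℂ)) i₀ = (((M ^ n).mulVec d i₀ : ℝ) : ℂ) := by
      simp [hpow, Matrix.mulVec, dotProduct]
    rw [this, Complex.norm_real]
    exact le_abs_self _
  have hlim := spectrum.pow_nnnorm_pow_one_div_tendsto_nhds_spectralRadius A
  have hlt : spectralRadius ℂ A < ENNReal.ofReal (1 + ε / 2) :=
    hle.trans_lt (ENNReal.one_lt_ofReal.2 (by linarith))
  have hev := (hlim.eventually_lt_const hlt).and (eventually_ge_atTop 1)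
  have hev2 : ∀ᶠ n : ℕ in atTop, ‖A ^ n‖ ≤ (1 + ε / 2) ^ n := by
    filter_upwards [hev] with n hn
    obtain ⟨hn, h1⟩ := hn
    have hn0 : (n : ℝ) ≠ 0 := by positivity
    have := ENNReal.rpow_le_rpow hn.le (Nat.cast_nonneg (α := ℝ) n)
    rw [← ENNReal.rpow_mul, one_div, inv_mul_cancel₀ hn0, ENNReal.rpow_one, ENNReal.rpow_natCast,
      ← ENNReal.ofReal_pow (by linarith)] at this
    rw [← ENNReal.ofReal_coe_nnreal, coe_nnnorm] at this
    exact (ENNReal.ofReal_le_ofReal_iff (by positivity)).1 this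
  have hratio : 1 < (1 + ε) / (1 + ε / 2) := by rw [one_lt_div (by linarith)]; linarith
  have htop := (tendsto_pow_atTop_atTop_of_one_lt hratio).atTop_mul_const hd
  obtain ⟨n, hn1, hn2⟩ :=
    (hev2.and (htop.eventually_gt_atTop ‖fun i => (d i : ℂ)‖)).exists
  have hp : 0 < (1 + ε / 2) ^ n := by positivity
  rw [div_pow, div_mul_eq_mul_div, lt_div_iff₀ hp] at hn2
  have := mul_le_mul_of_nonneg_right hn1 (norm_nonneg fun i => (d i : ℂ))
  linarith [hnorm n]

/-- At spectral radius one, a nonnegative subinvariant vector is invariant: otherwise applying a sum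
of powers of `M` makes the excess `M c - c` positive in every coordinate, and the vector grows
geometrically. -/
theorem mulVec_eq_self_of_le_mulVec {M : Matrix ι ι ℝ} (hM : ∀ i j, 0 ≤ M i j)
    (hirr : ∀ i j, ∃ n : ℕ, 0 < (M ^ n) i j)
    (hrad : spectralRadius ℂ (M.map (fun x : ℝ => (x : ℂ))) ≤ 1) {c : ι → ℝ}
    (h0 : ∀ i, 0 ≤ c i) (hc : ∀ i, c i ≤ M.mulVec c i) : M.mulVec c = c := by
  by_contra hne
  choose N hN using hirr
  obtain ⟨k, hk⟩ := Function.ne_iff.mp hne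
  set B : Matrix ι ι ℝ := ∑ i, M ^ N i k with hB
  have hBM : Commute M B := Commute.sum_right _ _ _ fun i _ => (Commute.refl M).pow_right _
  have hB0 : ∀ i j, 0 ≤ B i j := fun i j => by
    rw [hB, Matrix.sum_apply]
    exact Finset.sum_nonneg fun l _ => pow_nonneg_entries hM _ i j
  have hBk : ∀ i, 0 < B i k := fun i => by
    rw [hB, Matrix.sum_apply]
    exact Finset.sum_pos' (fun l _ => pow_nonneg_entries hM _ i k)
      ⟨i, Finset.mem_univ i, hN i k⟩
  set d := B.mulVec c with hd
  have hd0 : ∀ i, 0 ≤ d i := mulVec_nonneg hB0 h0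
  have he : ∀ i, 0 < M.mulVec d i - d i := by
    intro i
    have : M.mulVec d - d = B.mulVec (M.mulVec c - c) := by
      rw [hd, Matrix.mulVec_sub, Matrix.mulVec_mulVec, Matrix.mulVec_mulVec, hBM.eq]
    rw [← Pi.sub_apply, this]
    refine Finset.sum_pos' (fun l _ => mul_nonneg (hB0 i l) (sub_nonneg.mpr (hc l)))
      ⟨k, Finset.mem_univ k, mul_pos (hBk i) (sub_pos.mpr ?_)⟩
    exact lt_of_le_of_ne (hc k) (Ne.symm hk)
  obtain ⟨i₀, hi₀⟩ : ∃ i, 0 < d i := by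
    by_contra! hcon
    have hz : d = 0 := funext fun i => le_antisymm (hcon i) (hd0 i)
    have := he k
    simp [hz] at this
  have hε : ∀ᶠ ε : ℝ in 𝓝[>] 0, ∀ i, ε * d i < M.mulVec d i - d i := by
    refine eventually_all.2 fun i => ?_
    have : Tendsto (fun ε : ℝ => ε * d i) (𝓝[>] 0) (𝓝 (0 * d i)) :=
      (tendsto_nhdsWithin_of_tendsto_nhds tendsto_id).mul_const _
    rw [zero_mul] at this
    exact this.eventually_lt_const (he i)
  obtain ⟨ε, hε1, hε2⟩ := (hε.and self_mem_nhdsWithin).exists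
  exact absurd (one_lt_spectralRadius hM hi₀ (Set.mem_Ioi.mp hε2)
    fun i => by linarith [hε1 i]) (not_lt.mpr hrad)

/-- The normalized eigenvectors are positive, and a real fixed vector has constant sign. -/
theorem eigenvectors_pos {M : Matrix ι ι ℝ} (hM : ∀ i j, 0 ≤ M i j)
    (hirr : ∀ i j, ∃ n : ℕ, 0 < (M ^ n) i j)
    (hrad : spectralRadius ℂ (M.map (fun x : ℝ => (x : ℂ))) ≤ 1) {a b : ι → ℝ}
    (ha : Matrix.vecMul a M = a) (hb : M.mulVec b = b) (ha_one : ∑ j, a j = 1)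
    (hab : ∑ j, a j * b j = 1) :
    (∀ i, 0 < a i) ∧ (∀ i, 0 < b i) ∧
      ∀ v, M.mulVec v = v → v = 0 ∨ (∀ i, 0 < v i) ∨ ∀ i, v i < 0 := by
  have hsign : ∀ v, M.mulVec v = v → v = 0 ∨ (∀ i, 0 < v i) ∨ ∀ i, v i < 0 := fun v hv =>
    sign_of_mulVec_eq_self hM hirr hv
      (mulVec_eq_self_of_le_mulVec hM hirr hrad (fun i => abs_nonneg _) (abs_le_mulVec_abs hM hv))
  have hb0 : b ≠ 0 := by rintro rfl; simp at hab
  have hne : (Finset.univ : Finset ι).Nonempty := by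
    by_contra h
    rw [Finset.not_nonempty_iff_eq_empty] at h
    simp [h] at ha_one
  -- `|b|` is a positive right eigenvector; pairing with it turns `|a| ≤ |a| M` into an equality.
  have hbabs : M.mulVec (fun j => |b j|) = fun j => |b j| :=
    mulVec_eq_self_of_le_mulVec hM hirr hrad (fun i => abs_nonneg _) (abs_le_mulVec_abs hM hb)
  have hbpos : ∀ i, 0 < |b i| := by
    rcases eq_zero_or_pos_of_mulVec_eq_self hM hirr hbabs fun i => abs_nonneg _ with h | h
    · exact absurd (funext fun i => abs_eq_zero.mp (congrFun h i)) hb0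
    · exact h
  have hMt : ∀ i j, 0 ≤ M.transpose i j := fun i j => hM j i
  have hirrt : ∀ i j, ∃ n : ℕ, 0 < (M.transpose ^ n) i j := fun i j => by
    obtain ⟨n, hn⟩ := hirr j i
    exact ⟨n, by rw [← Matrix.transpose_pow]; exact hn⟩
  have hat : M.transpose.mulVec a = a := by rw [Matrix.mulVec_transpose, ha]
  have haabs : M.transpose.mulVec (fun j => |a j|) = fun j => |a j| := by
    have hle := abs_le_mulVec_abs hMt hat
    have hsum : ∑ i, M.transpose.mulVec (fun j => |a j|) i * |b i| = ∑ i, |a i| * |b i| := by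
      have := Matrix.dotProduct_mulVec (fun j => |a j|) M (fun j => |b j|)
      rw [hbabs] at this
      rw [Matrix.mulVec_transpose]
      exact this.symm
    have hz : ∑ i, (M.transpose.mulVec (fun j => |a j|) i - |a i|) * |b i| = 0 := by
      simp only [sub_mul, Finset.sum_sub_distrib]
      rw [hsum, sub_self]
    rw [Finset.sum_eq_zero_iff_of_nonneg fun i _ =>
      mul_nonneg (sub_nonneg.mpr (hle i)) (abs_nonneg _)] at hz
    funext i
    have := hz i (Finset.mem_univ i)
    rcases mul_eq_zero.mp this with h | h
    · exact sub_eq_zero.mp h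
    · exact absurd h (hbpos i).ne'
  have hapos : ∀ i, 0 < a i := by
    rcases sign_of_mulVec_eq_self hMt hirrt hat haabs with h | h | h
    · simp [h] at ha_one
    · exact h
    · have := Finset.sum_neg (fun i (_ : i ∈ Finset.univ) => h i) hne
      linarith
  refine ⟨hapos, ?_, hsign⟩
  rcases hsign b hb with h | h | h
  · exact absurd h hb0
  · exact h
  · have := Finset.sum_neg
      (fun i (_ : i ∈ Finset.univ) => mul_neg_of_pos_of_neg (hapos i) (h i)) hne
    linarith

end PerronFrobenius

/-! ### Expansion of a product over a word -/

section Words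

variable {α : Type*}

/-- The probability that all letters of `w` are killed, when a letter `l` survives with probability
`h l` and the letters are independent. -/
def killProb (h : α → ℝ) (w : List α) : ℝ := (w.map fun l => 1 - h l).prod

/-- The second-order remainder `∏ (1 - h l) - 1 + ∑ h l` of `killProb`. -/
def remainder (h : α → ℝ) (w : List α) : ℝ := killProb h w - 1 + (w.map h).sum

/-- The second elementary symmetric polynomial of the numbers `h l`, `l ∈ w`. -/
noncomputable def pairSum (h : α → ℝ) (w : List α) : ℝ :=
  ((w.map h).sum ^ 2 - (w.map fun l => h l ^ 2).sum) / 2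

@[simp] theorem killProb_nil (h : α → ℝ) : killProb h [] = 1 := rfl

@[simp] theorem killProb_cons (h : α → ℝ) (l : α) (w : List α) :
    killProb h (l :: w) = (1 - h l) * killProb h w := by simp [killProb]

@[simp] theorem remainder_nil (h : α → ℝ) : remainder h [] = 0 := by simp [remainder]

theorem remainder_cons (h : α → ℝ) (l : α) (w : List α) :
    remainder h (l :: w) = remainder h w + h l * (1 - killProb h w) := by
  simp only [remainder, killProb_cons, List.map_cons, List.sum_cons]; ring

@[simp] theorem pairSum_nil (h : α → ℝ) : pairSum h [] = 0 := by simp [pairSum]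

theorem pairSum_cons (h : α → ℝ) (l : α) (w : List α) :
    pairSum h (l :: w) = pairSum h w + h l * (w.map h).sum := by
  simp only [pairSum, List.map_cons, List.sum_cons]; ring

theorem sum_map_nonneg {h : α → ℝ} (h0 : ∀ l, 0 ≤ h l) (w : List α) : 0 ≤ (w.map h).sum :=
  List.sum_nonneg (by simpa using fun l _ => h0 l)

theorem killProb_nonneg {h : α → ℝ} (h1 : ∀ l, h l ≤ 1) (w : List α) : 0 ≤ killProb h w := by
  induction w with
  | nil => simp
  | cons l w ih => rw [killProb_cons]; exact mul_nonneg (sub_nonneg.mpr (h1 l)) ih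

theorem killProb_anti {h g : α → ℝ} (hg : ∀ l, h l ≤ g l) (g1 : ∀ l, g l ≤ 1) (w : List α) :
    killProb g w ≤ killProb h w := by
  induction w with
  | nil => simp
  | cons l w ih =>
    rw [killProb_cons, killProb_cons]
    exact mul_le_mul (by linarith [hg l]) ih (killProb_nonneg g1 w)
      (by linarith [hg l, g1 l])

theorem killProb_le_one {h : α → ℝ} (h0 : ∀ l, 0 ≤ h l) (h1 : ∀ l, h l ≤ 1) (w : List α) :
    killProb h w ≤ 1 := by
  refine (killProb_anti h0 h1 w).trans (le_of_eq ?_)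
  simp [killProb]

theorem killProb_lt_one {h : α → ℝ} (h0 : ∀ l, 0 < h l) (h1 : ∀ l, h l ≤ 1) {w : List α}
    (hw : w ≠ []) : killProb h w < 1 := by
  obtain ⟨l, w, rfl⟩ := List.exists_cons_of_ne_nil hw
  rw [killProb_cons]
  have := killProb_le_one (fun l => (h0 l).le) h1 w
  have := killProb_nonneg h1 w
  nlinarith [h0 l, h1 l]

theorem remainder_nonneg {h : α → ℝ} (h0 : ∀ l, 0 ≤ h l) (h1 : ∀ l, h l ≤ 1) (w : List α) :
    0 ≤ remainder h w := by
  induction w with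
  | nil => simp
  | cons l w ih =>
    rw [remainder_cons]
    exact add_nonneg ih (mul_nonneg (h0 l) (sub_nonneg.mpr (killProb_le_one h0 h1 w)))

theorem remainder_pos {h : α → ℝ} (h0 : ∀ l, 0 < h l) (h1 : ∀ l, h l ≤ 1) {w : List α}
    (hw : 2 ≤ w.length) : 0 < remainder h w := by
  match w, hw with
  | l :: l' :: w, _ =>
    rw [remainder_cons]
    exact add_pos_of_nonneg_of_pos (remainder_nonneg (fun l => (h0 l).le) h1 _)
      (mul_pos (h0 l) (sub_pos.mpr (killProb_lt_one h0 h1 (by simp))))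

theorem remainder_le_pairSum {h : α → ℝ} (h0 : ∀ l, 0 ≤ h l) (h1 : ∀ l, h l ≤ 1) (w : List α) :
    remainder h w ≤ pairSum h w := by
  induction w with
  | nil => simp
  | cons l w ih =>
    rw [remainder_cons, pairSum_cons]
    have := remainder_nonneg h0 h1 w
    rw [remainder] at this
    exact add_le_add ih (mul_le_mul_of_nonneg_left (by linarith) (h0 l))

theorem pairSum_nonneg {h : α → ℝ} (h0 : ∀ l, 0 ≤ h l) (w : List α) : 0 ≤ pairSum h w := by
  induction w with
  | nil => simp
  | cons l w ih =>
    rw [pairSum_cons]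
    exact add_nonneg ih (mul_nonneg (h0 l) (sum_map_nonneg h0 w))

theorem pairSum_pos {h : α → ℝ} (h0 : ∀ l, 0 < h l) {w : List α}
    (hw : 2 ≤ w.length) : 0 < pairSum h w := by
  match w, hw with
  | l :: l' :: w, _ =>
    rw [pairSum_cons]
    refine add_pos_of_nonneg_of_pos (pairSum_nonneg (fun l => (h0 l).le) _) (mul_pos (h0 l) ?_)
    rw [List.map_cons, List.sum_cons]
    exact add_pos_of_pos_of_nonneg (h0 l') (sum_map_nonneg (fun l => (h0 l).le) w)

theorem tendsto_sum_map {β : Type*} {f : Filter β} {u : β → α → ℝ} {b : α → ℝ}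
    (hu : ∀ l, Tendsto (fun n => u n l) f (𝓝 (b l))) (w : List α) :
    Tendsto (fun n => (w.map (u n)).sum) f (𝓝 (w.map b).sum) := by
  induction w with
  | nil => simpa using tendsto_const_nhds
  | cons l w ih => simpa using (hu l).add ih

theorem tendsto_killProb {β : Type*} {f : Filter β} {u : β → α → ℝ} {b : α → ℝ}
    (hu : ∀ l, Tendsto (fun n => u n l) f (𝓝 (b l))) (w : List α) :
    Tendsto (fun n => killProb (u n) w) f (𝓝 (killProb b w)) := by
  induction w with
  | nil => simpa using tendsto_const_nhds
  | cons l w ih => simpa using ((hu l).const_sub 1).mul ih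

/-- The remainder is asymptotically quadratic along small multiples of a convergent sequence of
directions. -/
theorem tendsto_remainder_div {β : Type*} {f : Filter β} {s : β → ℝ} {u : β → α → ℝ} {b : α → ℝ}
    (hs : Tendsto s f (𝓝 0)) (hs0 : ∀ n, s n ≠ 0)
    (hu : ∀ l, Tendsto (fun n => u n l) f (𝓝 (b l))) (w : List α) :
    Tendsto (fun n => remainder (fun l => s n * u n l) w / s n ^ 2) f (𝓝 (pairSum b w)) := by
  induction w with
  | nil => simpa using tendsto_const_nhds
  | cons l w ih =>
    -- `(1 - killProb) / s` is the first-order term minus `s` times the remainder over `s ^ 2`.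
    have h1 : Tendsto (fun n => (w.map (u n)).sum -
        s n * (remainder (fun l => s n * u n l) w / s n ^ 2)) f (𝓝 ((w.map b).sum)) := by
      have := (tendsto_sum_map hu w).sub (hs.mul ih)
      simpa using this
    rw [pairSum_cons]
    refine (ih.add ((hu l).mul h1)).congr fun n => ?_
    have hsum : (w.map fun l => s n * u n l).sum = s n * (w.map (u n)).sum :=
      List.sum_map_mul_left w (u n) (s n)
    have hk : 1 - killProb (fun l => s n * u n l) w =
        s n * (w.map (u n)).sum - remainder (fun l => s n * u n l) w := by
      rw [remainder, hsum]; ring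
    rw [remainder_cons, hk]
    have := hs0 n
    field_simp

end Words

section Counts

variable {K : ℕ}

theorem sum_map_eq_sum_typeCount (h : Fin K → ℝ) (w : List (Fin K)) :
    (w.map h).sum = ∑ j, (typeCount w j : ℝ) * h j := by
  induction w with
  | nil => simp [typeCount]
  | cons l w ih =>
    simp only [List.map_cons, List.sum_cons, ih, typeCount, List.count_cons, Nat.cast_add, add_mul,
      Finset.sum_add_distrib]
    simp [add_comm]

theorem length_eq_sum_typeCount (w : List (Fin K)) : w.length = ∑ j, typeCount w j := by
  have := sum_map_eq_sum_typeCount (fun _ => (1 : ℝ)) w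
  simp only [List.map_const', List.sum_replicate, mul_one, nsmul_eq_mul] at this
  exact_mod_cast this

/-- The second partial derivative at `(1, …, 1)` of the monomial with exponents `typeCount w`. -/
def pairCount (w : List (Fin K)) (j k : Fin K) : ℕ :=
  if j = k then typeCount w j * (typeCount w j - 1) else typeCount w j * typeCount w k

theorem pairSum_eq (h : Fin K → ℝ) (w : List (Fin K)) :
    pairSum h w = (∑ j, ∑ k, (pairCount w j k : ℝ) * h j * h k) / 2 := by
  rw [pairSum, sum_map_eq_sum_typeCount, sum_map_eq_sum_typeCount (fun l => h l ^ 2)]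
  congr 1
  have hq : ∀ j k, (pairCount w j k : ℝ) =
      typeCount w j * typeCount w k - if j = k then (typeCount w j : ℝ) else 0 := by
    intro j k
    unfold pairCount
    split_ifs with hjk
    · subst hjk
      rcases Nat.eq_zero_or_pos (typeCount w j) with h0 | h0
      · simp [h0]
      · push_cast [Nat.cast_sub h0]; ring
    · push_cast; ring
  rw [sq, Finset.sum_mul_sum, ← Finset.sum_sub_distrib]
  refine Finset.sum_congr rfl fun j _ => ?_
  simp only [hq, sub_mul, Finset.sum_sub_distrib, ite_mul, zero_mul, Finset.sum_ite_eq,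
    Finset.mem_univ, if_true]
  congr 1
  · exact Finset.sum_congr rfl fun k _ => by ring
  · ring

theorem pairSum_le {h : Fin K → ℝ} (h0 : ∀ l, 0 ≤ h l) {C : ℝ} (hC : ∀ l, h l ≤ C)
    (w : List (Fin K)) : pairSum h w ≤ (∑ j, ∑ k, (pairCount w j k : ℝ) * C * C) / 2 := by
  rw [pairSum_eq]
  gcongr with j _ k _
  · exact h0 k
  · exact mul_nonneg (Nat.cast_nonneg _) ((h0 j).trans (hC j))
  · exact hC j
  · exact hC k

end Counts

/-! ### Expansion of the generating functions -/

section Expect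

variable {K : ℕ} (ζ : Fin K → PMF (List (Fin K)))

theorem tsum_mul_map {α β : Type*} (p : PMF α) (g : α → β) (f : β → ℝ≥0∞) :
    ∑' z, f z * (p.map g) z = ∑' w, f (g w) * p w := by
  classical
  simp_rw [PMF.map_apply, ← ENNReal.tsum_mul_left]
  rw [ENNReal.tsum_comm]
  refine tsum_congr fun w => ?_
  rw [tsum_eq_single (g w)]
  · simp
  · intro z hz; simp [hz]

theorem hasSum_toReal_mul {α : Type*} (p : PMF α) (f : α → ℕ)
    (h : ∑' w, (f w : ℝ≥0∞) * p w ≠ ∞) :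
    HasSum (fun w => (p w).toReal * f w) (∑' w, (f w : ℝ≥0∞) * p w).toReal := by
  have := ENNReal.hasSum_toReal h
  rw [ENNReal.tsum_toReal_eq (fun w => ENNReal.ne_top_of_tsum_ne_top h w)]
  simpa [ENNReal.toReal_mul, mul_comm] using this

theorem hasSum_pmf {α : Type*} (p : PMF α) : HasSum (fun w => (p w).toReal) 1 := by
  have := hasSum_toReal_mul p (fun _ => 1) (by simp [p.tsum_coe])
  simpa [p.tsum_coe] using this

theorem hasSum_mean (i j : Fin K) (h : meanMatrix (unordered ζ) i j ≠ ∞) :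
    HasSum (fun w => (ζ i w).toReal * (typeCount w j : ℝ)) (realMeanMatrix (unordered ζ) i j) := by
  have e : meanMatrix (unordered ζ) i j = ∑' w, (typeCount w j : ℝ≥0∞) * ζ i w :=
    tsum_mul_map (ζ i) typeCount fun z => (z j : ℝ≥0∞)
  rw [realMeanMatrix, e]
  exact hasSum_toReal_mul (ζ i) _ (e ▸ h)

theorem hasSum_secondDeriv (i j k : Fin K) (h : secondDeriv (unordered ζ) i j k ≠ ∞) :
    HasSum (fun w => (ζ i w).toReal * (pairCount w j k : ℝ))
      (secondDeriv (unordered ζ) i j k).toReal := by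
  have e : secondDeriv (unordered ζ) i j k = ∑' w, (pairCount w j k : ℝ≥0∞) * ζ i w :=
    tsum_mul_map (ζ i) typeCount fun z =>
      ((if j = k then z j * (z j - 1) else z j * z k : ℕ) : ℝ≥0∞)
  rw [e]
  exact hasSum_toReal_mul (ζ i) _ (e ▸ h)

/-- The probability that an individual of type `i` has a surviving child, when a child of type `l`
survives with probability `h l`, independently of the others. -/
noncomputable def survStep (h : Fin K → ℝ) (i : Fin K) : ℝ :=
  ∑' w, (ζ i w).toReal * (1 - killProb h w)

/-- The expected remainder: the difference between the linear part of `survStep` and `survStep`. -/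
noncomputable def survRem (h : Fin K → ℝ) (i : Fin K) : ℝ :=
  ∑' w, (ζ i w).toReal * remainder h w

variable {ζ}

theorem summable_one_sub_killProb {h : Fin K → ℝ} (h0 : ∀ l, 0 ≤ h l) (h1 : ∀ l, h l ≤ 1)
    (i : Fin K) : Summable fun w => (ζ i w).toReal * (1 - killProb h w) := by
  refine Summable.of_nonneg_of_le (fun w => mul_nonneg ENNReal.toReal_nonneg
    (sub_nonneg.mpr (killProb_le_one h0 h1 w))) (fun w => ?_) (hasSum_pmf (ζ i)).summable
  exact mul_le_of_le_one_right ENNReal.toReal_nonneg (by linarith [killProb_nonneg h1 w])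

theorem survStep_nonneg {h : Fin K → ℝ} (h0 : ∀ l, 0 ≤ h l) (h1 : ∀ l, h l ≤ 1)
    (i : Fin K) : 0 ≤ survStep ζ h i :=
  tsum_nonneg fun w => mul_nonneg ENNReal.toReal_nonneg
    (sub_nonneg.mpr (killProb_le_one h0 h1 w))

theorem survStep_mono {h g : Fin K → ℝ} (h0 : ∀ l, 0 ≤ h l) (hg : ∀ l, h l ≤ g l)
    (g1 : ∀ l, g l ≤ 1) (i : Fin K) : survStep ζ h i ≤ survStep ζ g i :=
  Summable.tsum_le_tsum (fun w => mul_le_mul_of_nonneg_left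
      (by linarith [killProb_anti hg g1 w]) ENNReal.toReal_nonneg)
    (summable_one_sub_killProb h0 (fun l => (hg l).trans (g1 l)) i)
    (summable_one_sub_killProb (fun l => (h0 l).trans (hg l)) g1 i)

theorem survStep_le_one {h : Fin K → ℝ} (h0 : ∀ l, 0 ≤ h l) (h1 : ∀ l, h l ≤ 1)
    (i : Fin K) : survStep ζ h i ≤ 1 := by
  rw [← (hasSum_pmf (ζ i)).tsum_eq]
  exact Summable.tsum_le_tsum (fun w => mul_le_of_le_one_right ENNReal.toReal_nonneg
      (by linarith [killProb_nonneg h1 w]))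
    (summable_one_sub_killProb h0 h1 i) (hasSum_pmf (ζ i)).summable

theorem survStep_pos {h : Fin K → ℝ} (h0 : ∀ l, 0 < h l) (h1 : ∀ l, h l ≤ 1) {i : Fin K}
    {w : List (Fin K)} (hw : ζ i w ≠ 0) (hw0 : w ≠ []) : 0 < survStep ζ h i := by
  refine (summable_one_sub_killProb (fun l => (h0 l).le) h1 i).tsum_pos (fun w => mul_nonneg
    ENNReal.toReal_nonneg (sub_nonneg.mpr (killProb_le_one (fun l => (h0 l).le) h1 w))) w ?_
  exact mul_pos (ENNReal.toReal_pos hw ((ζ i).apply_ne_top w))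
    (sub_pos.mpr (killProb_lt_one h0 h1 hw0))

theorem tendsto_survStep {u : ℕ → Fin K → ℝ} {b : Fin K → ℝ} (u0 : ∀ n l, 0 ≤ u n l)
    (u1 : ∀ n l, u n l ≤ 1) (hu : ∀ l, Tendsto (fun n => u n l) atTop (𝓝 (b l))) (i : Fin K) :
    Tendsto (fun n => survStep ζ (u n) i) atTop (𝓝 (survStep ζ b i)) := by
  refine tendsto_tsum_of_dominated_convergence (hasSum_pmf (ζ i)).summable
    (fun w => ((tendsto_killProb hu w).const_sub 1).const_mul _)
    (Eventually.of_forall fun n w => ?_)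
  have h2 := killProb_le_one (u0 n) (u1 n) w
  rw [Real.norm_of_nonneg (mul_nonneg ENNReal.toReal_nonneg (sub_nonneg.mpr h2))]
  exact mul_le_of_le_one_right ENNReal.toReal_nonneg (by linarith [killProb_nonneg (u1 n) w])

theorem hasSum_linear (hm : ∀ i j, meanMatrix (unordered ζ) i j ≠ ∞) (h : Fin K → ℝ) (i : Fin K) :
    HasSum (fun w => (ζ i w).toReal * (w.map h).sum)
      ((realMeanMatrix (unordered ζ)).mulVec h i) := by
  have := hasSum_sum fun j (_ : j ∈ Finset.univ) => (hasSum_mean ζ i j (hm i j)).mul_right (h j)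
  have e : (fun w => (ζ i w).toReal * (w.map h).sum) =
      fun w => ∑ j, (ζ i w).toReal * (typeCount w j : ℝ) * h j := by
    funext w
    rw [sum_map_eq_sum_typeCount, Finset.mul_sum]
    exact Finset.sum_congr rfl fun j _ => (mul_assoc _ _ _).symm
  rw [e]
  exact this

theorem hasSum_quad (hq : FiniteVariance (unordered ζ)) (h : Fin K → ℝ) (i : Fin K) :
    HasSum (fun w => (ζ i w).toReal * pairSum h w) (quadForm (unordered ζ) i h / 2) := by
  have := (hasSum_sum fun j (_ : j ∈ Finset.univ) => hasSum_sum fun k (_ : k ∈ Finset.univ) =>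
    ((hasSum_secondDeriv ζ i j k (hq i j k)).mul_right (h j)).mul_right (h k)).div_const 2
  have e : (fun w => (ζ i w).toReal * pairSum h w) =
      fun w => (∑ j, ∑ k, (ζ i w).toReal * (pairCount w j k : ℝ) * h j * h k) / 2 := by
    funext w
    rw [pairSum_eq, ← mul_div_assoc, Finset.mul_sum]
    congr 1
    refine Finset.sum_congr rfl fun j _ => ?_
    rw [Finset.mul_sum]
    exact Finset.sum_congr rfl fun k _ => by ring
  rw [e]
  exact this

theorem summable_remainder (hq : FiniteVariance (unordered ζ)) {h : Fin K → ℝ}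
    (h0 : ∀ l, 0 ≤ h l) (h1 : ∀ l, h l ≤ 1) (i : Fin K) :
    Summable fun w => (ζ i w).toReal * remainder h w :=
  Summable.of_nonneg_of_le
    (fun w => mul_nonneg ENNReal.toReal_nonneg (remainder_nonneg h0 h1 w))
    (fun w => mul_le_mul_of_nonneg_left (remainder_le_pairSum h0 h1 w) ENNReal.toReal_nonneg)
    (hasSum_quad hq h i).summable

theorem survStep_eq (hm : ∀ i j, meanMatrix (unordered ζ) i j ≠ ∞)
    (hq : FiniteVariance (unordered ζ)) {h : Fin K → ℝ}
    (h0 : ∀ l, 0 ≤ h l) (h1 : ∀ l, h l ≤ 1) (i : Fin K) :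
    survStep ζ h i = (realMeanMatrix (unordered ζ)).mulVec h i - survRem ζ h i := by
  rw [survRem, ← ((hasSum_linear hm h i).sub (summable_remainder hq h0 h1 i).hasSum).tsum_eq,
    survStep]
  exact tsum_congr fun w => by rw [remainder]; ring

theorem survRem_nonneg {h : Fin K → ℝ} (h0 : ∀ l, 0 ≤ h l) (h1 : ∀ l, h l ≤ 1) (i : Fin K) :
    0 ≤ survRem ζ h i :=
  tsum_nonneg fun w => mul_nonneg ENNReal.toReal_nonneg (remainder_nonneg h0 h1 w)

theorem survRem_le (hq : FiniteVariance (unordered ζ)) {h : Fin K → ℝ}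
    (h0 : ∀ l, 0 ≤ h l) (h1 : ∀ l, h l ≤ 1) (i : Fin K) :
    survRem ζ h i ≤ quadForm (unordered ζ) i h / 2 := by
  rw [← (hasSum_quad hq h i).tsum_eq]
  exact Summable.tsum_le_tsum
    (fun w => mul_le_mul_of_nonneg_left (remainder_le_pairSum h0 h1 w) ENNReal.toReal_nonneg)
    (summable_remainder hq h0 h1 i) (hasSum_quad hq h i).summable

/-- The second-order expansion of the generating functions at `(1, …, 1)`. -/
theorem tendsto_survRem_div (hq : FiniteVariance (unordered ζ)) {s : ℕ → ℝ} {u : ℕ → Fin K → ℝ}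
    {b : Fin K → ℝ} (hs : Tendsto s atTop (𝓝 0)) (hs0 : ∀ n, 0 < s n)
    (u0 : ∀ n l, 0 ≤ u n l) (u1 : ∀ n l, s n * u n l ≤ 1)
    (hu : ∀ l, Tendsto (fun n => u n l) atTop (𝓝 (b l))) (i : Fin K) :
    Tendsto (fun n => survRem ζ (fun l => s n * u n l) i / s n ^ 2) atTop
      (𝓝 (quadForm (unordered ζ) i b / 2)) := by
  obtain ⟨C, hC⟩ : ∃ C, ∀ l, b l < C := by
    obtain ⟨C, hC⟩ := (Set.finite_range b).bddAbove
    exact ⟨C + 1, fun l => by linarith [hC ⟨l, rfl⟩]⟩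
  have hev : ∀ᶠ n in atTop, ∀ l, u n l < C :=
    eventually_all.2 fun l => (hu l).eventually_lt_const (hC l)
  rw [← (hasSum_quad hq b i).tsum_eq]
  simp_rw [survRem, ← tsum_div_const, mul_div_assoc]
  refine tendsto_tsum_of_dominated_convergence (hasSum_quad hq (fun _ => C) i).summable
    (fun w => (tendsto_remainder_div hs (fun n => (hs0 n).ne') hu w).const_mul _) ?_
  filter_upwards [hev] with n hn w
  have hsu : ∀ l, 0 ≤ s n * u n l := fun l => mul_nonneg (hs0 n).le (u0 n l)
  rw [Real.norm_of_nonneg (mul_nonneg ENNReal.toReal_nonneg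
    (div_nonneg (remainder_nonneg hsu (u1 n) w) (sq_nonneg _)))]
  refine mul_le_mul_of_nonneg_left ?_ ENNReal.toReal_nonneg
  rw [div_le_iff₀ (pow_pos (hs0 n) 2)]
  refine (remainder_le_pairSum hsu (u1 n) w).trans ?_
  have : pairSum (fun l => s n * u n l) w = pairSum (u n) w * s n ^ 2 := by
    simp only [pairSum, mul_pow, List.sum_map_mul_left]; ring
  rw [this]
  refine mul_le_mul_of_nonneg_right ?_ (sq_nonneg _)
  rw [pairSum_eq (fun _ => C)]
  exact pairSum_le (u0 n) (fun l => (hn l).le) w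

end Expect

/-! ### Consequences of the basic assumption -/

section Assumption

variable {K : ℕ} {ζ : Fin K → PMF (List (Fin K))}

theorem toReal_pow_entries {ι : Type*} [Fintype ι] [DecidableEq ι] {A : Matrix ι ι ℝ≥0∞}
    (hA : ∀ i j, A i j ≠ ∞) (n : ℕ) : ∀ i j, (A ^ n) i j ≠ ∞ ∧
      ((A ^ n) i j).toReal = ((A.map ENNReal.toReal) ^ n) i j := by
  induction n with
  | zero =>
    intro i j
    simp only [pow_zero, Matrix.one_apply]
    split_ifs <;> simp
  | succ n ih =>
    intro i j
    have hfin : ∀ k ∈ Finset.univ, (A ^ n) i k * A k j ≠ ∞ := fun k _ =>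
      ENNReal.mul_ne_top (ih i k).1 (hA k j)
    rw [pow_succ, pow_succ, Matrix.mul_apply, Matrix.mul_apply, ENNReal.toReal_sum hfin]
    refine ⟨ENNReal.sum_ne_top.2 hfin, Finset.sum_congr rfl fun k _ => ?_⟩
    rw [ENNReal.toReal_mul, (ih i k).2, Matrix.map_apply]

theorem realMeanMatrix_nonneg (μ : Fin K → PMF (Fin K → ℕ)) (i j : Fin K) :
    0 ≤ realMeanMatrix μ i j := ENNReal.toReal_nonneg

theorem realMeanMatrix_irreducible {μ : Fin K → PMF (Fin K → ℕ)} (h : Irreducible μ)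
    (hm : ∀ i j, meanMatrix μ i j ≠ ∞) (i j : Fin K) :
    ∃ n : ℕ, 0 < (realMeanMatrix μ ^ n) i j := by
  obtain ⟨n, -, hn⟩ := h i j
  refine ⟨n, ?_⟩
  have := toReal_pow_entries hm n i j
  rw [show realMeanMatrix μ = (meanMatrix μ).map ENNReal.toReal from rfl, ← this.2]
  exact ENNReal.toReal_pos hn.ne' this.1

/-- A critical nondegenerate process branches: if no word had two letters, the row sums of the mean
matrix would be at most one, hence equal to one by pairing with the left eigenvector, and every
word would have exactly one letter. -/
theorem exists_two_le_length (hnd : NonDegenerate (unordered ζ))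
    (hm : ∀ i j, meanMatrix (unordered ζ) i j ≠ ∞) {a : Fin K → ℝ}
    (ha : Matrix.vecMul a (realMeanMatrix (unordered ζ)) = a) (ha0 : ∀ i, 0 < a i) :
    ∃ i w, ζ i w ≠ 0 ∧ 2 ≤ w.length := by
  by_contra! hcon
  have hlen : ∀ i w, 0 ≤ (ζ i w).toReal * (1 - w.length : ℝ) := by
    intro i w
    by_cases hw : ζ i w = 0
    · simp [hw]
    · have : (w.length : ℝ) ≤ 1 := by exact_mod_cast Nat.lt_succ_iff.mp (hcon i w hw)
      exact mul_nonneg ENNReal.toReal_nonneg (by linarith)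
  have hsum : ∀ i, HasSum (fun w => (ζ i w).toReal * (1 - w.length : ℝ))
      (1 - (realMeanMatrix (unordered ζ)).mulVec (fun _ => 1) i) := by
    intro i
    have := (hasSum_pmf (ζ i)).sub (hasSum_linear hm (fun _ => 1) i)
    simpa [mul_sub] using this
  have hrow : ∀ i, 0 ≤ 1 - (realMeanMatrix (unordered ζ)).mulVec (fun _ => 1) i :=
    fun i => (hsum i).nonneg (hlen i)
  have hz : ∑ i, a i * (1 - (realMeanMatrix (unordered ζ)).mulVec (fun _ => 1) i) = 0 := by
    have := Matrix.dotProduct_mulVec a (realMeanMatrix (unordered ζ)) (fun _ => 1)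
    rw [ha] at this
    simp only [dotProduct] at this
    simp only [mul_sub, Finset.sum_sub_distrib, this, sub_self]
  rw [Finset.sum_eq_zero_iff_of_nonneg fun i _ => mul_nonneg (ha0 i).le (hrow i)] at hz
  obtain ⟨i, hi⟩ := hnd
  have hi0 := (mul_eq_zero.mp (hz i (Finset.mem_univ i))).resolve_left (ha0 i).ne'
  have hs := hsum i
  rw [hi0] at hs
  have hzero := (hasSum_zero_iff_of_nonneg (hlen i)).1 hs
  have hdisj := (PMF.toMeasure_apply_eq_zero_iff (unordered ζ i)
    (MeasurableSet.of_discrete (s := {z : Fin K → ℕ | ∑ j, z j ≠ 1}))).not.1 hi.ne'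
  obtain ⟨z, hz1, hz2⟩ := Set.not_disjoint_iff.1 hdisj
  rw [unordered, PMF.mem_support_map_iff] at hz1
  obtain ⟨w, hw, rfl⟩ := hz1
  refine hz2 ?_
  rw [← length_eq_sum_typeCount]
  have := congrFun hzero w
  rw [Pi.zero_apply, mul_eq_zero] at this
  rcases this with h | h
  · exact absurd h (ENNReal.toReal_pos hw ((ζ i).apply_ne_top w)).ne'
  · exact_mod_cast (sub_eq_zero.mp h).symm

theorem quadForm_smul {μ : Fin K → PMF (Fin K → ℕ)} (c : ℝ) (s : Fin K → ℝ) (i : Fin K) :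
    quadForm μ i (c • s) = c ^ 2 * quadForm μ i s := by
  simp only [quadForm, Finset.mul_sum, Pi.smul_apply, smul_eq_mul]
  exact Finset.sum_congr rfl fun j _ => Finset.sum_congr rfl fun k _ => by ring

theorem quadForm_mono {μ : Fin K → PMF (Fin K → ℕ)} {s t : Fin K → ℝ} (s0 : ∀ l, 0 ≤ s l)
    (hst : ∀ l, s l ≤ t l) (i : Fin K) : quadForm μ i s ≤ quadForm μ i t := by
  unfold quadForm
  gcongr with j _ k _
  · exact s0 k
  · exact mul_nonneg ENNReal.toReal_nonneg ((s0 j).trans (hst j))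
  · exact hst j
  · exact hst k

end Assumption

/-! ### Asymptotics of the survival probabilities -/

section Asymptotics

variable {K : ℕ} (ζ : Fin K → PMF (List (Fin K)))

/-- The probability that the tree with root of type `i` reaches height `n`, by recursion on `n`. -/
noncomputable def survProb : ℕ → Fin K → ℝ
  | 0 => fun _ => 1
  | n + 1 => survStep ζ (survProb n)

variable {ζ}

theorem survProb_mem (n : ℕ) : (∀ i, 0 ≤ survProb ζ n i) ∧ ∀ i, survProb ζ n i ≤ 1 := by
  induction n with
  | zero => simp [survProb]
  | succ n ih => exact ⟨survStep_nonneg ih.1 ih.2, survStep_le_one ih.1 ih.2⟩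

theorem survProb_succ_le (n : ℕ) : ∀ i, survProb ζ (n + 1) i ≤ survProb ζ n i := by
  induction n with
  | zero => exact fun i => (survProb_mem 1).2 i
  | succ n ih =>
    exact survStep_mono (survProb_mem (n + 1)).1 ih (survProb_mem n).2

theorem antitone_survProb (i : Fin K) : Antitone fun n => survProb ζ n i :=
  antitone_nat_of_succ_le fun n => survProb_succ_le n i

/-- Convergence of `n * s n` for a positive sequence with `s n - s (n + 1) ~ c * s n ^ 2`: the
increments of `1 / s n` converge to `c`. -/
theorem tendsto_nat_mul_of_quadratic {s : ℕ → ℝ} {c : ℝ} (hs : ∀ n, 0 < s n) (hc : c ≠ 0)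
    (hs0 : Tendsto s atTop (𝓝 0))
    (hrec : Tendsto (fun n => (s n - s (n + 1)) / s n ^ 2) atTop (𝓝 c)) :
    Tendsto (fun n : ℕ => n * s n) atTop (𝓝 (1 / c)) := by
  have hratio : Tendsto (fun n => s (n + 1) / s n) atTop (𝓝 1) := by
    have := (hs0.mul hrec).const_sub 1
    simp only [zero_mul, sub_zero] at this
    refine this.congr fun n => ?_
    have := (hs n).ne'
    field_simp
    ring
  have hinc : Tendsto (fun n => (s (n + 1))⁻¹ - (s n)⁻¹) atTop (𝓝 c) := by
    have := hrec.div hratio one_ne_zero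
    rw [div_one] at this
    refine this.congr fun n => ?_
    have := (hs n).ne'
    have := (hs (n + 1)).ne'
    simp only [Pi.div_apply]
    field_simp
  have hces := hinc.cesaro
  simp_rw [Finset.sum_range_sub (fun n => (s n)⁻¹)] at hces
  have h0 : Tendsto (fun n : ℕ => (n : ℝ)⁻¹ * (s 0)⁻¹) atTop (𝓝 0) := by
    simpa using tendsto_inv_atTop_nhds_zero_nat.mul_const ((s 0)⁻¹)
  have h1 := (hces.add h0).inv₀ (by simpa using hc)
  rw [add_zero] at h1
  rw [one_div]
  refine h1.congr fun n => ?_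
  have e : (n : ℝ)⁻¹ * ((s n)⁻¹ - (s 0)⁻¹) + (n : ℝ)⁻¹ * (s 0)⁻¹ = (n : ℝ)⁻¹ * (s n)⁻¹ := by ring
  rw [e, mul_inv, inv_inv, inv_inv]

/-- The properties of the offspring distribution and of its normalized eigenvectors `a`, `b` on
which the asymptotics rest: finite first and second moments, positivity of the eigenvectors,
constant sign of the fixed vectors of the mean matrix, and branching. -/
structure CriticalData (ζ : Fin K → PMF (List (Fin K))) (a b : Fin K → ℝ) : Prop where
  mean_ne_top : ∀ i j, meanMatrix (unordered ζ) i j ≠ ∞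
  finiteVariance : FiniteVariance (unordered ζ)
  left_eq : Matrix.vecMul a (realMeanMatrix (unordered ζ)) = a
  right_eq : (realMeanMatrix (unordered ζ)).mulVec b = b
  pairing_eq_one : ∑ j, a j * b j = 1
  left_pos : ∀ i, 0 < a i
  right_pos : ∀ i, 0 < b i
  sign : ∀ v, (realMeanMatrix (unordered ζ)).mulVec v = v →
    v = 0 ∨ (∀ i, 0 < v i) ∨ ∀ i, v i < 0
  branching : ∃ i w, ζ i w ≠ 0 ∧ 2 ≤ w.length

namespace CriticalData

variable {a b : Fin K → ℝ} (H : CriticalData ζ a b)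
include H

/-- The linear functional `h ↦ ∑ i, a i * h i` is invariant under the mean matrix. -/
theorem pairing_mulVec (h : Fin K → ℝ) :
    ∑ i, a i * (realMeanMatrix (unordered ζ)).mulVec h i = ∑ i, a i * h i := by
  have := Matrix.dotProduct_mulVec a (realMeanMatrix (unordered ζ)) h
  rwa [H.left_eq] at this

/-- Pairing with the left eigenvector removes the linear part of `survStep`. -/
theorem pairing_survStep {h : Fin K → ℝ} (h0 : ∀ l, 0 ≤ h l) (h1 : ∀ l, h l ≤ 1) :
    ∑ i, a i * survStep ζ h i = ∑ i, a i * h i - ∑ i, a i * survRem ζ h i := by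
  simp only [survStep_eq H.mean_ne_top H.finiteVariance h0 h1, mul_sub, Finset.sum_sub_distrib,
    H.pairing_mulVec]

theorem pairing_quadForm_pos :
    0 < ∑ i, a i * quadForm (unordered ζ) i b := by
  have hnn : ∀ i w, 0 ≤ (ζ i w).toReal * pairSum b w := fun i w =>
    mul_nonneg ENNReal.toReal_nonneg (pairSum_nonneg (fun l => (H.right_pos l).le) w)
  obtain ⟨i, w, hw, hlen⟩ := H.branching
  refine Finset.sum_pos' (fun j _ => mul_nonneg (H.left_pos j).le ?_)
    ⟨i, Finset.mem_univ i, mul_pos (H.left_pos i) ?_⟩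
  · linarith [(hasSum_quad H.finiteVariance b j).nonneg (hnn j)]
  · have h1 := (hasSum_quad H.finiteVariance b i).summable.tsum_pos (hnn i) w
      (mul_pos (ENNReal.toReal_pos hw ((ζ i).apply_ne_top w)) (pairSum_pos H.right_pos hlen))
    rw [(hasSum_quad H.finiteVariance b i).tsum_eq] at h1
    linarith

/-- Almost sure extinction: the decreasing limit is a fixed point of `survStep`; pairing with the
left eigenvector shows that the remainder vanishes there, which is impossible for a positive vector
because the process branches. -/
theorem tendsto_survProb_zero (i : Fin K) : Tendsto (fun n => survProb ζ n i) atTop (𝓝 0) := by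
  have hlim : ∀ i, ∃ L, Tendsto (fun n => survProb ζ n i) atTop (𝓝 L) := fun i =>
    ⟨_, tendsto_atTop_ciInf (antitone_survProb i)
      ⟨0, by rintro _ ⟨n, rfl⟩; exact (survProb_mem n).1 i⟩⟩
  choose L hL using hlim
  have L0 : ∀ i, 0 ≤ L i := fun i => ge_of_tendsto' (hL i) fun n => (survProb_mem n).1 i
  have L1 : ∀ i, L i ≤ 1 := fun i => le_of_tendsto' (hL i) fun n => (survProb_mem n).2 i
  have hfix : ∀ i, survStep ζ L i = L i := fun i =>
    tendsto_nhds_unique (tendsto_survStep (fun n => (survProb_mem n).1)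
      (fun n => (survProb_mem n).2) hL i) ((hL i).comp (tendsto_add_atTop_nat 1))
  have hrem : ∀ i, survRem ζ L i = 0 := by
    have h := H.pairing_survStep L0 L1
    simp only [hfix] at h
    have h' : ∑ i, a i * survRem ζ L i = 0 := by linarith
    rw [Finset.sum_eq_zero_iff_of_nonneg fun i _ =>
      mul_nonneg (H.left_pos i).le (survRem_nonneg L0 L1 i)] at h'
    exact fun i => (mul_eq_zero.mp (h' i (Finset.mem_univ i))).resolve_left (H.left_pos i).ne'
  have hML : (realMeanMatrix (unordered ζ)).mulVec L = L := by
    funext i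
    have := survStep_eq H.mean_ne_top H.finiteVariance L0 L1 i
    rw [hfix, hrem, sub_zero] at this
    exact this.symm
  rcases H.sign L hML with h | h | h
  · simpa [h] using hL i
  · exfalso
    obtain ⟨i, w, hw, hlen⟩ := H.branching
    have := (summable_remainder H.finiteVariance L0 L1 i).tsum_pos
      (fun w => mul_nonneg ENNReal.toReal_nonneg (remainder_nonneg L0 L1 w)) w
      (mul_pos (ENNReal.toReal_pos hw ((ζ i).apply_ne_top w)) (remainder_pos h L1 hlen))
    exact this.ne' (hrem i)
  · exact absurd (h i) (not_lt.mpr (L0 i))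

theorem tendsto_pairing_survProb :
    Tendsto (fun n => ∑ j, a j * survProb ζ n j) atTop (𝓝 0) := by
  have := tendsto_finsetSum Finset.univ fun j (_ : j ∈ Finset.univ) =>
    (H.tendsto_survProb_zero j).const_mul (a j)
  simpa using this

theorem survProb_pos (n : ℕ) :
    ∀ i, 0 < survProb ζ n i := by
  induction n with
  | zero => simp [survProb]
  | succ n ih =>
    intro i
    obtain ⟨w, hw, hw0⟩ : ∃ w, ζ i w ≠ 0 ∧ w ≠ [] := by
      by_contra! hcon
      have h := hasSum_linear H.mean_ne_top b i
      have hz : (fun w => (ζ i w).toReal * (w.map b).sum) = 0 := by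
        funext w
        by_cases hw : ζ i w = 0
        · simp [hw]
        · simp [hcon w hw]
      rw [hz, H.right_eq] at h
      exact (H.right_pos i).ne' (h.unique hasSum_zero)
    exact survStep_pos ih (survProb_mem n).2 hw hw0

/-- The directions of the vectors `survProb ζ n` converge to `b`. Monotonicity in `n` gives
`M h - h ≤ O(‖h‖ ^ 2)`, and the left eigenvector turns this one-sided bound into
`M u - u → 0` for the normalized vectors `u`, whatever the period of `M`. -/
theorem tendsto_direction (i : Fin K) :
    Tendsto (fun n => survProb ζ n i / ∑ j, a j * survProb ζ n j) atTop (𝓝 (b i)) := by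
  set M := realMeanMatrix (unordered ζ) with hM
  set s : ℕ → ℝ := fun n => ∑ j, a j * survProb ζ n j with hs
  set u : ℕ → Fin K → ℝ := fun n l => survProb ζ n l / s n with hu
  have hspos : ∀ n, 0 < s n := fun n => Finset.sum_pos
    (fun j _ => mul_pos (H.left_pos j) (H.survProb_pos n j)) ⟨i, Finset.mem_univ i⟩
  have hs0 : Tendsto s atTop (𝓝 0) := H.tendsto_pairing_survProb
  have hsu : ∀ n l, survProb ζ n l = s n * u n l := fun n l =>
    (mul_div_cancel₀ _ (hspos n).ne').symm
  have u0 : ∀ n l, 0 ≤ u n l := fun n l => div_nonneg ((survProb_mem n).1 l) (hspos n).le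
  have ule : ∀ n l, u n l ≤ (a l)⁻¹ := by
    intro n l
    rw [hu, div_le_iff₀ (hspos n), le_inv_mul_iff₀ (H.left_pos l)]
    exact Finset.single_le_sum (f := fun j => a j * survProb ζ n j)
      (fun j _ => mul_nonneg (H.left_pos j).le ((survProb_mem n).1 j)) (Finset.mem_univ l)
  have hau : ∀ n, ∑ j, a j * u n j = 1 := by
    intro n
    simp only [hu, ← mul_div_assoc, ← Finset.sum_div]
    exact div_self (hspos n).ne'
  -- `ρ n` bounds the excess of `M u` over `u`, and vanishes in the limit.
  set ρ : ℕ → Fin K → ℝ := fun n j => s n * (quadForm (unordered ζ) j (fun l => (a l)⁻¹) / 2)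
    with hρ
  have hρ0 : ∀ j, Tendsto (fun n => ρ n j) atTop (𝓝 0) := fun j => by
    simpa using hs0.mul_const (quadForm (unordered ζ) j (fun l => (a l)⁻¹) / 2)
  have hupper : ∀ n j, 0 ≤ u n j - M.mulVec (u n) j + ρ n j := by
    intro n j
    have hMh : M.mulVec (survProb ζ n) j = s n * M.mulVec (u n) j := by
      rw [show survProb ζ n = s n • u n from funext (hsu n), Matrix.mulVec_smul]; rfl
    have h1 := survStep_eq H.mean_ne_top H.finiteVariance (survProb_mem (ζ := ζ) n).1
      (survProb_mem n).2 j
    have h2 := survRem_le H.finiteVariance (survProb_mem (ζ := ζ) n).1 (survProb_mem n).2 j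
    have h3 : survStep ζ (survProb ζ n) j ≤ survProb ζ n j := survProb_succ_le n j
    have h4 : quadForm (unordered ζ) j (survProb ζ n) ≤
        s n ^ 2 * quadForm (unordered ζ) j (fun l => (a l)⁻¹) := by
      rw [show survProb ζ n = s n • u n from funext (hsu n), quadForm_smul]
      exact mul_le_mul_of_nonneg_left (quadForm_mono (u0 n) (ule n) j) (sq_nonneg _)
    have h5 : 0 ≤ s n * (u n j - M.mulVec (u n) j + ρ n j) := by
      rw [← hM, hMh] at h1
      rw [hsu n j] at h3
      have : s n * ρ n j = s n ^ 2 * quadForm (unordered ζ) j (fun l => (a l)⁻¹) / 2 := by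
        simp only [hρ]; ring
      rw [mul_add, mul_sub, this]
      linarith
    exact nonneg_of_mul_nonneg_right h5 (hspos n)
  have hzero : Tendsto (fun n => u n - M.mulVec (u n)) atTop (𝓝 0) := by
    refine tendsto_pi_nhds.2 fun j => ?_
    have hlow : Tendsto (fun n => -ρ n j) atTop (𝓝 0) := by simpa using (hρ0 j).neg
    have hhigh : Tendsto (fun n => (a j)⁻¹ * ∑ k, a k * ρ n k) atTop (𝓝 0) := by
      have := (tendsto_finsetSum Finset.univ fun k (_ : k ∈ Finset.univ) =>
        (hρ0 k).const_mul (a k)).const_mul (a j)⁻¹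
      simpa using this
    refine tendsto_of_tendsto_of_tendsto_of_le_of_le hlow hhigh
      (fun n => by have := hupper n j; simp only [Pi.sub_apply]; linarith) (fun n => ?_)
    rw [Pi.sub_apply, le_inv_mul_iff₀ (H.left_pos j)]
    have h1 := Finset.single_le_sum (f := fun k => a k * (u n k - M.mulVec (u n) k + ρ n k))
      (fun k _ => mul_nonneg (H.left_pos k).le (hupper n k)) (Finset.mem_univ j)
    simp only [mul_add, mul_sub, Finset.sum_add_distrib, Finset.sum_sub_distrib] at h1
    rw [hM, H.pairing_mulVec, sub_self, zero_add, ← hM] at h1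
    have h2 : 0 ≤ a j * ρ n j := by
      refine mul_nonneg (H.left_pos j).le (mul_nonneg (hspos n).le (div_nonneg ?_ zero_le_two))
      have := quadForm_mono (μ := unordered ζ) (s := fun _ => 0) (fun _ => le_rfl)
        (fun l => (inv_pos.2 (H.left_pos l)).le) j
      simpa [quadForm] using this
    rw [mul_sub]
    linarith
  -- Every limit point of `u` is a fixed vector with the same pairing with `a` as `b`.
  have huniq : Tendsto u atTop (𝓝 b) := by
    refine (isCompact_univ_pi fun l => isCompact_Icc (a := (0 : ℝ)) (b := (a l)⁻¹)
      ).tendsto_nhds_of_unique_mapClusterPt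
      (Eventually.of_forall fun n l _ => ⟨u0 n l, ule n l⟩) fun v _ hv => ?_
    obtain ⟨U, hU, hUv⟩ := mapClusterPt_iff_ultrafilter.1 hv
    have hcont : Continuous fun w : Fin K → ℝ => w - M.mulVec w := by fun_prop
    have hfix : v - M.mulVec v = 0 :=
      tendsto_nhds_unique ((hcont.tendsto v).comp hUv) (hzero.mono_left hU)
    have hav : ∑ j, a j * v j = 1 := by
      have hc : Continuous fun w : Fin K → ℝ => ∑ j, a j * w j := by fun_prop
      refine tendsto_nhds_unique ((hc.tendsto v).comp hUv) ?_
      exact tendsto_const_nhds.congr fun n => (hau n).symm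
    have hd : ∑ j, a j * (v - b) j = 0 := by
      simp [mul_sub, Finset.sum_sub_distrib, hav, H.pairing_eq_one]
    rcases H.sign (v - b) (by
      rw [Matrix.mulVec_sub, H.right_eq, ← hM, ← sub_eq_zero.1 hfix]) with h | h | h
    · exact sub_eq_zero.1 h
    · exact absurd hd (Finset.sum_pos (fun j _ => mul_pos (H.left_pos j) (h j))
        ⟨i, Finset.mem_univ i⟩).ne'
    · exact absurd hd (Finset.sum_neg (fun j _ => mul_neg_of_pos_of_neg (H.left_pos j) (h j))
        ⟨i, Finset.mem_univ i⟩).ne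
  exact tendsto_pi_nhds.1 huniq i

theorem tendsto_nat_mul_survProb (i : Fin K) :
    Tendsto (fun n : ℕ => n * survProb ζ n i) atTop
      (𝓝 (2 * b i / ∑ j, a j * quadForm (unordered ζ) j b)) := by
  set s : ℕ → ℝ := fun n => ∑ j, a j * survProb ζ n j with hs
  have hspos : ∀ n, 0 < s n := fun n => Finset.sum_pos
    (fun j _ => mul_pos (H.left_pos j) (H.survProb_pos n j)) ⟨i, Finset.mem_univ i⟩
  have hs0 : Tendsto s atTop (𝓝 0) := H.tendsto_pairing_survProb
  have hdir := H.tendsto_direction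
  have hu : ∀ n, (fun l => s n * (survProb ζ n l / s n)) = survProb ζ n := fun n => by
    funext l
    exact mul_div_cancel₀ _ (hspos n).ne'
  have hQ := H.pairing_quadForm_pos
  have hrem : ∀ j, Tendsto (fun n => survRem ζ (survProb ζ n) j / s n ^ 2) atTop
      (𝓝 (quadForm (unordered ζ) j b / 2)) := fun j => by
    have := tendsto_survRem_div H.finiteVariance hs0 hspos (u := fun n l => survProb ζ n l / s n)
      (fun n l => div_nonneg ((survProb_mem n).1 l) (hspos n).le)
      (fun n l => (congrFun (hu n) l).le.trans ((survProb_mem n).2 l)) hdir j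
    simpa only [hu] using this
  have hrec : Tendsto (fun n => (s n - s (n + 1)) / s n ^ 2) atTop
      (𝓝 ((∑ j, a j * quadForm (unordered ζ) j b) / 2)) := by
    have := tendsto_finsetSum Finset.univ fun j (_ : j ∈ Finset.univ) => (hrem j).const_mul (a j)
    simp only [← mul_div_assoc, ← Finset.sum_div] at this
    refine this.congr fun n => ?_
    have h := H.pairing_survStep (survProb_mem (ζ := ζ) n).1 (survProb_mem n).2
    have h' : s (n + 1) = s n - ∑ j, a j * survRem ζ (survProb ζ n) j := h
    rw [h']
    congr 1
    ring
  have hmain := (tendsto_nat_mul_of_quadratic hspos (by positivity) hs0 hrec).mul (hdir i)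
  rw [show 2 * b i / ∑ j, a j * quadForm (unordered ζ) j b =
    1 / ((∑ j, a j * quadForm (unordered ζ) j b) / 2) * b i by field_simp]
  refine hmain.congr fun n => ?_
  have := (hspos n).ne'
  simp only [hs] at this ⊢
  field_simp

end CriticalData

end Asymptotics

/-! ### The law of the height -/

section Height

variable {K : ℕ} {ζ : Fin K → PMF (List (Fin K))}

/-- If `u` has type `j`, the subtree of its descendants reaches height `n` above `u`. -/
def Reaches (W : Fin K × List ℕ → List (Fin K)) (n : ℕ) (j : Fin K) (u : List ℕ) : Prop :=
  ∃ v : List ℕ, v.length = n ∧ (follow W j u v).isSome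

theorem reaches_zero (W : Fin K × List ℕ → List (Fin K)) (j : Fin K) (u : List ℕ) :
    Reaches W 0 j u := ⟨[], rfl, rfl⟩

theorem reaches_succ (W : Fin K × List ℕ → List (Fin K)) (n : ℕ) (j : Fin K) (u : List ℕ) :
    Reaches W (n + 1) j u ↔ ∃ l k, (W (j, u))[l]? = some k ∧ Reaches W n k (u ++ [l]) := by
  constructor
  · rintro ⟨v, hv, hf⟩
    obtain ⟨l, v, rfl⟩ := List.exists_cons_of_length_eq_add_one hv
    rw [follow] at hf
    cases h : (W (j, u))[l]? with
    | none => simp [h] at hf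
    | some k =>
      simp only [h] at hf
      exact ⟨l, k, h, v, by simpa using hv, hf⟩
  · rintro ⟨l, k, h, v, hv, hf⟩
    refine ⟨l :: v, by simp [hv], ?_⟩
    simp only [follow, h]
    exact hf

/-- The σ-algebra generated by the coordinates in `S`. -/
@[reducible]
def coordAlgebra (S : Set (Fin K × List ℕ)) :
    MeasurableSpace (Fin K × List ℕ → List (Fin K)) :=
  ⨆ q ∈ S, MeasurableSpace.comap (fun W => W q) ⊤

theorem coordAlgebra_mono {S T : Set (Fin K × List ℕ)} (h : S ⊆ T) :
    coordAlgebra S ≤ coordAlgebra T := biSup_mono h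

theorem coordAlgebra_le (S : Set (Fin K × List ℕ)) : coordAlgebra S ≤ MeasurableSpace.pi :=
  iSup₂_le fun q _ => (measurable_pi_apply q).comap_le

theorem measurableSet_coordAlgebra {S : Set (Fin K × List ℕ)} {q : Fin K × List ℕ} (hq : q ∈ S)
    (p : List (Fin K) → Prop) : MeasurableSet[coordAlgebra S] {W | p (W q)} :=
  (le_iSup₂ (f := fun q (_ : q ∈ S) => MeasurableSpace.comap
    (fun W : Fin K × List ℕ → List (Fin K) => W q) ⊤) q hq) _ ⟨{w | p w}, trivial, rfl⟩

/-- Events depending on disjoint sets of vertices are independent. -/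
theorem wordLaw_inter {S T : Set (Fin K × List ℕ)} (hST : Disjoint S T)
    {A B : Set (Fin K × List ℕ → List (Fin K))} (hA : MeasurableSet[coordAlgebra S] A)
    (hB : MeasurableSet[coordAlgebra T] B) :
    wordLaw ζ (A ∩ B) = wordLaw ζ A * wordLaw ζ B := by
  have h := ProbabilityTheory.iIndepFun_infinitePi
    (P := fun q : Fin K × List ℕ => (ζ q.1).toMeasure) (X := fun _ w => w)
    (fun _ => measurable_id)
  rw [ProbabilityTheory.iIndepFun_iff_iIndep] at h
  have h2 := ProbabilityTheory.indep_iSup_of_disjoint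
    (fun q => (measurable_pi_apply q).comap_le) h hST
  exact (ProbabilityTheory.Indep_iff _ _ _).1 h2 A B hA hB

theorem wordLaw_coord (q : Fin K × List ℕ) (w : List (Fin K)) :
    wordLaw ζ {W | W q = w} = ζ q.1 w := by
  have hw : MeasurableSet ({w} : Set (List (Fin K))) := trivial
  rw [← PMF.toMeasure_apply_singleton (ζ q.1) w hw,
    ← Measure.infinitePi_map_eval (fun q : Fin K × List ℕ => (ζ q.1).toMeasure) q,
    Measure.map_apply (measurable_pi_apply q) hw]
  rfl

/-- The coordinates attached to the descendants of `u`. -/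
def descIndex (u : List ℕ) : Set (Fin K × List ℕ) := {q | ∃ v, q.2 = u ++ v}

/-- The coordinates attached to the children of `u` numbered from `m` on and their descendants. -/
def laterIndex (u : List ℕ) (m : ℕ) : Set (Fin K × List ℕ) :=
  {q | ∃ l v, m ≤ l ∧ q.2 = u ++ l :: v}

/-- The event that the subtree above a vertex `u` of type `j` does not reach height `n`. -/
def dies (n : ℕ) (j : Fin K) (u : List ℕ) : Set (Fin K × List ℕ → List (Fin K)) :=
  {W | ¬ Reaches W n j u}

/-- The event that no subtree above a child of `u` numbered from `m` on reaches height `n`, when the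
word of the types of these children is `w`. -/
def childrenDie (n : ℕ) (u : List ℕ) : List (Fin K) → ℕ →
    Set (Fin K × List ℕ → List (Fin K))
  | [], _ => Set.univ
  | k :: w, m => dies n k (u ++ [m]) ∩ childrenDie n u w (m + 1)

theorem mem_childrenDie {n : ℕ} {u : List ℕ} {W : Fin K × List ℕ → List (Fin K)}
    (w : List (Fin K)) : ∀ m, W ∈ childrenDie n u w m ↔
      ∀ l k, w[l]? = some k → ¬ Reaches W n k (u ++ [m + l]) := by
  induction w with
  | nil => simp [childrenDie]
  | cons k w ih =>
    intro m
    simp only [childrenDie, Set.mem_inter_iff, ih, dies, Set.mem_ofPred_eq]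
    constructor
    · rintro ⟨h1, h2⟩ l k' hl
      cases l with
      | zero =>
        simp only [List.getElem?_cons_zero, Option.some.injEq] at hl
        subst hl
        exact h1
      | succ l =>
        have := h2 l k' (by simpa using hl)
        rwa [add_assoc, add_comm 1 l] at this
    · intro h
      refine ⟨h 0 k (by simp), fun l k' hl => ?_⟩
      have := h (l + 1) k' (by simpa using hl)
      rwa [add_assoc, add_comm 1 l]

theorem dies_succ_inter (n : ℕ) (j : Fin K) (u : List ℕ) (w : List (Fin K)) :
    {W | W (j, u) = w} ∩ dies (n + 1) j u = {W | W (j, u) = w} ∩ childrenDie n u w 0 := by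
  ext W
  simp only [Set.mem_inter_iff, Set.mem_ofPred_eq, mem_childrenDie, zero_add, dies, reaches_succ,
    not_exists, not_and]
  refine and_congr_right fun h => ?_
  rw [h]

theorem measurableSet_dies (n : ℕ) : ∀ (j : Fin K) (u : List ℕ),
    MeasurableSet[coordAlgebra (descIndex u)] (dies n j u) := by
  induction n with
  | zero =>
    intro j u
    have : dies 0 j u = ∅ := by ext W; simp [dies, reaches_zero]
    rw [this]
    exact @MeasurableSet.empty _ (coordAlgebra (descIndex u))
  | succ n ih =>
    intro j u
    have : dies (n + 1) j u =
        ⋂ l : ℕ, ⋂ k : Fin K, ({W | ¬ (W (j, u))[l]? = some k} ∪ dies n k (u ++ [l])) := by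
      ext W
      simp only [dies, reaches_succ, not_exists, not_and, Set.mem_ofPred_eq, Set.mem_iInter,
        Set.mem_union, imp_iff_not_or]
    rw [this]
    refine MeasurableSet.iInter fun l => MeasurableSet.iInter fun k => ?_
    refine @MeasurableSet.union _ (coordAlgebra (descIndex u)) _ _
      (measurableSet_coordAlgebra (show (j, u) ∈ descIndex u from ⟨[], by simp⟩)
        fun w => ¬ w[l]? = some k) ?_
    refine coordAlgebra_mono ?_ _ (ih k (u ++ [l]))
    rintro q ⟨v, hv⟩
    exact ⟨l :: v, by simp [hv]⟩

theorem measurableSet_childrenDie (n : ℕ) (u : List ℕ) (w : List (Fin K)) : ∀ m,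
    MeasurableSet[coordAlgebra (laterIndex u m)] (childrenDie n u w m) := by
  induction w with
  | nil => exact fun m => @MeasurableSet.univ _ (coordAlgebra (laterIndex u m))
  | cons k w ih =>
    intro m
    refine @MeasurableSet.inter _ (coordAlgebra (laterIndex u m)) _ _
      (coordAlgebra_mono ?_ _ (measurableSet_dies n k (u ++ [m])))
      (coordAlgebra_mono ?_ _ (ih (m + 1)))
    · rintro q ⟨v, hv⟩
      exact ⟨m, v, le_rfl, by simp [hv]⟩
    · rintro q ⟨l, v, hl, hv⟩
      exact ⟨l, v, by omega, hv⟩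

theorem disjoint_descIndex_laterIndex (u : List ℕ) (m : ℕ) :
    Disjoint (descIndex (K := K) (u ++ [m])) (laterIndex u (m + 1)) := by
  rw [Set.disjoint_left]
  rintro ⟨_, q⟩ ⟨v, hv⟩ ⟨l, v', hl, hv'⟩
  simp only [List.append_assoc, List.singleton_append] at hv hv'
  rw [hv] at hv'
  have := (List.cons.inj (List.append_cancel_left hv')).1
  omega

theorem disjoint_singleton_laterIndex (j : Fin K) (u : List ℕ) :
    Disjoint {(j, u)} (laterIndex u 0) := by
  rw [Set.disjoint_singleton_left]
  rintro ⟨l, v, -, hv⟩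
  simp at hv

/-- The recursion for the survival probabilities, from the independence of the subtrees of the
children of a vertex. -/
theorem wordLaw_dies (n : ℕ) : ∀ (j : Fin K) (u : List ℕ),
    (wordLaw ζ).real (dies n j u) = 1 - survProb ζ n j := by
  induction n with
  | zero =>
    intro j u
    have : dies 0 j u = ∅ := by ext W; simp [dies, reaches_zero]
    simp [this, survProb]
  | succ n ih =>
    intro j u
    have hchildren : ∀ w m, (wordLaw ζ).real (childrenDie n u w m) =
        killProb (survProb ζ n) w := by
      intro w
      induction w with
      | nil => intro m; simp [childrenDie]
      | cons k w ihw =>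
        intro m
        rw [childrenDie, measureReal_def, wordLaw_inter (disjoint_descIndex_laterIndex u m)
          (measurableSet_dies n k _) (measurableSet_childrenDie n u w (m + 1)),
          ENNReal.toReal_mul, killProb_cons, ← ih k (u ++ [m]), ← ihw (m + 1)]
        rfl
    have hcoord : ∀ w, MeasurableSet {W : Fin K × List ℕ → List (Fin K) | W (j, u) = w} :=
      fun w => coordAlgebra_le {(j, u)} _
        (measurableSet_coordAlgebra (Set.mem_singleton _) fun w' => w' = w)
    have hunion : dies (n + 1) j u = ⋃ w, ({W | W (j, u) = w} ∩ dies (n + 1) j u) := by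
      ext W; simp
    have hmeas : wordLaw ζ (dies (n + 1) j u) =
        ∑' w, ζ j w * wordLaw ζ (childrenDie n u w 0) := by
      rw [hunion, measure_iUnion]
      · refine tsum_congr fun w => ?_
        rw [dies_succ_inter, wordLaw_inter (disjoint_singleton_laterIndex j u)
          (measurableSet_coordAlgebra (Set.mem_singleton _) fun w' => w' = w)
          (measurableSet_childrenDie n u w 0), wordLaw_coord]
      · intro w w' hww
        rw [Function.onFun, Set.disjoint_left]
        rintro W ⟨h1, -⟩ ⟨h2, -⟩
        exact hww (h1.symm.trans h2)
      · exact fun w => (hcoord w).inter (coordAlgebra_le _ _ (measurableSet_dies (n + 1) j u))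
    have hsum := (hasSum_pmf (ζ j)).sub
      (summable_one_sub_killProb (ζ := ζ) (survProb_mem (ζ := ζ) n).1
        (survProb_mem n).2 j).hasSum
    rw [measureReal_def, hmeas, ENNReal.tsum_toReal_eq fun w =>
      ENNReal.mul_ne_top ((ζ j).apply_ne_top w) (measure_ne_top _ _)]
    rw [show survProb ζ (n + 1) j =
      ∑' w, (ζ j w).toReal * (1 - killProb (survProb ζ n) w) from rfl, ← hsum.tsum_eq]
    refine tsum_congr fun w => ?_
    rw [ENNReal.toReal_mul, ← measureReal_def, hchildren]
    ring

theorem wordLaw_reaches (n : ℕ) (j : Fin K) (u : List ℕ) :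
    (wordLaw ζ).real {W | Reaches W n j u} = survProb ζ n j := by
  have h := probReal_compl_eq_one_sub (μ := wordLaw ζ)
    (coordAlgebra_le _ _ (measurableSet_dies n j u))
  rw [wordLaw_dies, sub_sub_cancel] at h
  rw [← h]
  congr 1
  ext W
  simp [dies]

theorem append_singleton_mem_vertexSet {i : Fin K} {W : Fin K × List ℕ → List (Fin K)}
    {u : List ℕ} {l : ℕ} (h : u ++ [l] ∈ vertexSet i W) :
    u ∈ vertexSet i W ∧ ∃ j, l < (W (j, u)).length := by
  simp only [vertexSet, Set.mem_ofPred_eq, mark_append] at h ⊢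
  cases hm : mark i W u with
  | none => simp [hm] at h
  | some j =>
    simp only [hm, Option.bind_some, isSome_getElem?] at h
    exact ⟨rfl, j, h⟩

/-- A vertex of height at least `n` has an ancestor of height exactly `n`. -/
theorem reaches_of_mem_vertexSet {i : Fin K} {W : Fin K × List ℕ → List (Fin K)} {n : ℕ}
    (u : List ℕ) : u ∈ vertexSet i W → n ≤ u.length → Reaches W n i [] := by
  induction u using List.reverseRecOn with
  | nil =>
    intro _ hn
    rw [Nat.le_zero.1 hn]
    exact reaches_zero W i []
  | append_singleton u l ih =>
    intro hu hn
    rcases Nat.lt_or_ge u.length n with h | h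
    · refine ⟨u ++ [l], ?_, hu⟩
      simp only [List.length_append, List.length_singleton] at hn ⊢
      omega
    · exact ih (append_singleton_mem_vertexSet hu).1 h

theorem finite_generation (i : Fin K) (W : Fin K × List ℕ → List (Fin K)) (n : ℕ) :
    {u ∈ vertexSet i W | u.length = n}.Finite := by
  induction n with
  | zero => exact (Set.finite_singleton []).subset fun u hu => List.length_eq_zero_iff.1 hu.2
  | succ n ih =>
    refine (ih.biUnion fun u _ => Set.finite_iUnion fun j : Fin K =>
      ((Set.finite_Iio (W (j, u)).length).image fun l => u ++ [l])).subset ?_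
    rintro v ⟨hv, hlen⟩
    obtain ⟨u, l, rfl⟩ := (List.eq_nil_or_concat v).resolve_left (by rintro rfl; simp at hlen)
    rw [List.concat_eq_append] at hv hlen ⊢
    obtain ⟨hu, j, hl⟩ := append_singleton_mem_vertexSet hv
    simp only [Set.mem_iUnion]
    exact ⟨u, ⟨hu, by simpa using hlen⟩, j, l, hl, rfl⟩

theorem reaches_of_infinite {i : Fin K} {W : Fin K × List ℕ → List (Fin K)}
    (h : ¬ (vertexSet i W).Finite) (n : ℕ) : Reaches W n i [] := by
  by_contra hn
  refine h (((Set.finite_Iio n).biUnion fun m _ => finite_generation i W m).subset fun u hu => ?_)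
  simp only [Set.mem_iUnion]
  refine ⟨u.length, ?_, hu, rfl⟩
  by_contra hlen
  exact hn (reaches_of_mem_vertexSet u hu (not_lt.1 hlen))

theorem le_height_gwTree_iff {i : Fin K} {W : Fin K × List ℕ → List (Fin K)}
    (h : (vertexSet i W).Finite) (n : ℕ) : n ≤ (gwTree i W).height ↔ Reaches W n i [] := by
  rw [gwTree, dif_pos h]
  constructor
  · intro hn
    obtain ⟨u, hu, hmax⟩ := Finset.exists_mem_eq_sup _ ⟨[], (treeOfFinite i W h).root_mem⟩
      List.length
    refine reaches_of_mem_vertexSet u (h.mem_toFinset.1 hu) ?_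
    rw [TypedTree.height, hmax] at hn
    exact hn
  · rintro ⟨v, rfl, hv⟩
    exact Finset.le_sup (f := List.length) (h.mem_toFinset.2 hv)

/-- When the survival probabilities vanish in the limit, the tree is almost surely finite, and the
law of its height is given by `survProb`. -/
theorem gwLaw_le_height (i : Fin K)
    (hext : Tendsto (fun n => survProb ζ n i) atTop (𝓝 0)) (n : ℕ) :
    (gwLaw ζ i).real {t | n ≤ t.height} = survProb ζ n i := by
  have hfin : ∀ᵐ W ∂(wordLaw ζ), (vertexSet i W).Finite := by
    rw [ae_iff, ← measureReal_eq_zero_iff]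
    refine le_antisymm (ge_of_tendsto' hext fun n => ?_) measureReal_nonneg
    rw [← wordLaw_reaches n i []]
    exact measureReal_mono fun W hW => reaches_of_infinite hW n
  rw [gwLaw, map_measureReal_apply (measurable_gwTree i) trivial, ← wordLaw_reaches n i []]
  refine measureReal_congr ?_
  filter_upwards [hfin] with W hW
  exact propext (le_height_gwTree_iff hW n)

end Height

/-! ### The limit under the basic assumption -/

/-- The basic assumption provides the data on which the asymptotics rest. -/
theorem BasicAssumption.criticalData {K : ℕ} {ζ : Fin K → PMF (List (Fin K))}
    (hH : BasicAssumption (unordered ζ)) {a b : Fin K → ℝ}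
    (ha : Matrix.vecMul a (realMeanMatrix (unordered ζ)) = a)
    (hb : Matrix.mulVec (realMeanMatrix (unordered ζ)) b = b)
    (ha_one : ∑ j, a j = 1) (hab : ∑ j, a j * b j = 1) : CriticalData ζ a b := by
  obtain ⟨hm, hrad⟩ := hH.critical
  obtain ⟨ha0, hb0, hsign⟩ := eigenvectors_pos (realMeanMatrix_nonneg _)
    (realMeanMatrix_irreducible hH.irreducible hm) hrad.le ha hb ha_one hab
  exact ⟨hm, hH.finiteVariance, ha, hb, hab, ha0, hb0, hsign,
    exists_two_le_length hH.nonDegenerate hm ha ha0⟩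

end MultitypeGW

theorem corollary1 {K : ℕ} (ζ : Fin K → PMF (List (Fin K)))
    (hH : MultitypeGW.BasicAssumption (MultitypeGW.unordered ζ))
    (a b : Fin K → ℝ)
    (ha : Matrix.vecMul a (MultitypeGW.realMeanMatrix (MultitypeGW.unordered ζ)) = a)
    (hb : Matrix.mulVec (MultitypeGW.realMeanMatrix (MultitypeGW.unordered ζ)) b = b)
    (ha_one : ∑ j, a j = 1) (hab : ∑ j, a j * b j = 1) (i : Fin K) :
    Filter.Tendsto
      (fun n : ℕ => (n : ℝ) *
        (MultitypeGW.gwLaw ζ i).real {t : MultitypeGW.TypedTree K | n ≤ t.height})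
      Filter.atTop
      (nhds (2 * b i / ∑ j, a j * MultitypeGW.quadForm (MultitypeGW.unordered ζ) j b)) := by
  have H := hH.criticalData ha hb ha_one hab
  simp only [MultitypeGW.gwLaw_le_height i (H.tendsto_survProb_zero i)]
  exact H.tendsto_nat_mul_survProb i
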